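/- Let $B_\varepsilon(x)\subset\mathbb R^2$ be the open disk of centre $x$ and radius $\varepsilon$, and let $B_1=B_1(0)$. Let $u$ be the velocity field given in polar coordinates by $u(r,\theta)=2\pi r^2(\sin\theta,-\cos\theta)$. Let $\rho_0\in L^\infty(\mathbb R^2)$ vanish outside $\overline{B_1}$ and satisfy $\int_0^{2\pi}\rho_0(r\cos\theta,r\sin\theta)\,d\theta=0$ for almost every $r>0$. Then the Cauchy problem $\partial_t\rho+\operatorname{div}(u\rho)=0$ on $[0,\infty)\times B_1$, $\rho(0,\cdot)=\rho_0$, has a bounded weak solution $\rho$, extended by zero outside $\overline{B_1}$, where the equation means that $$\int_{B_1}\rho(t,x)\varphi(x)\,dx=\int_{B_1}\rho_0(x)\varphi(x)\,dx+\int_0^t\int_{B_1}\rho(s,x)\,u(x)\cdot\nabla\varphi(x)\,dx\,ds\qquad\text{for all }t\ge0,\ \varphi\in C_c^\infty(B_1).$$ Moreover, every such solution $\rho$ satisfies $$\mathcal G_\kappa(\rho(t,\cdot))\to0\ \text{ for every }\kappa\in(0,1),\qquad\text{and}\qquad \|\rho(t,\cdot)\|_{\dot H^{-1}(B_1)}\to0,\qquad\text{as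 }t\to\infty.$$ Here the geometric mixing scale $\mathcal G_\kappa(f)$ with accuracy $\kappa$ is the infimum of all $\varepsilon>0$ such that $$\Big|\frac1{|B_\varepsilon(x)|}\int_{B_\varepsilon(x)}f(y)\,dy\Big|\le\kappa\,\|f\|_{L^\infty(B_1)}\qquad\text{for every }x\in\mathbb R^2,$$ and $$\|f\|_{\dot H^{-1}(B_1)}=\sup\Big\{\int_{B_1}f\,\xi\,dx:\ \xi\in H^1(B_1),\ \|\nabla\xi\|_{L^2(B_1)}\le1\Big\}.$$ -/

import Mathlib

open MeasureTheory Set Filter Topology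
open scoped ContDiff ENNReal

noncomputable section

namespace DiskMixing

/-- The Euclidean plane. -/
abbrev Plane : Type := EuclideanSpace ℝ (Fin 2)

/-- The open unit disk. -/
def disk : Set Plane := Metric.ball 0 1

/-- The point with polar coordinates `(r, θ)`. -/
def polar (r θ : ℝ) : Plane := !₂[r * Real.cos θ, r * Real.sin θ]

/-- The velocity field `2 π r² (sin θ, -cos θ)`, in Cartesian coordinates. -/
def velocity (x : Plane) : Plane := (2 * Real.pi * ‖x‖) • !₂[x 1, -x 0]

/-- The polar form of the velocity field. -/
theorem velocity_polar (r θ : ℝ) (hr : 0 ≤ r) :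
    velocity (polar r θ) = (2 * Real.pi * r ^ 2) • !₂[Real.sin θ, -Real.cos θ] := by
  have h : ‖polar r θ‖ = r := by
    rw [EuclideanSpace.norm_eq]
    simp only [polar, Fin.sum_univ_two, Real.norm_eq_abs, sq_abs]
    have : (r * Real.cos θ) ^ 2 + (r * Real.sin θ) ^ 2 = r ^ 2 := by
      nlinarith [Real.sin_sq_add_cos_sq θ]
    simp [this, Real.sqrt_sq hr]
  unfold velocity
  rw [h]
  ext i
  fin_cases i <;> simp [polar] <;> ring

/-- Smooth functions with compact support inside the open unit disk. -/
def IsTestFunction (φ : Plane → ℝ) : Prop :=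
  ContDiff ℝ ∞ φ ∧ HasCompactSupport φ ∧ tsupport φ ⊆ disk

/-- The admissible initial data: (classes of) bounded measurable functions that vanish almost
everywhere outside the closed unit disk and whose average over almost every circle centered at
the origin is zero. -/
structure IsAdmissibleDatum (ρ₀ : Plane → ℝ) : Prop where
  memLp : MemLp ρ₀ ∞ volume
  support : ∀ᵐ x : Plane, x ∉ Metric.closedBall (0 : Plane) 1 → ρ₀ x = 0
  circle_average : ∀ᵐ r : ℝ, 0 < r → ∫ θ in (0 : ℝ)..(2 * Real.pi), ρ₀ (polar r θ) = 0

/-- `ρ` is a bounded weak (distributional) solution on `[0, ∞)` times the unit disk of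
`∂ₜρ + div (v ρ) = 0` with `ρ(0, ·) = ρ₀`, extended by zero outside the disk. The equation is
imposed in its time-integrated form at every time `t ≥ 0`; so `ρ(t, ·)` is meaningful for
every `t` (it is the weakly-* continuous representative). -/
structure IsWeakSolution (v : Plane → Plane) (ρ₀ : Plane → ℝ) (ρ : ℝ → Plane → ℝ) : Prop where
  measurable : AEStronglyMeasurable (Function.uncurry ρ)
    ((volume.restrict (Ici (0 : ℝ))).prod (volume.restrict disk))
  measurable_slice : ∀ t : ℝ, 0 ≤ t → AEStronglyMeasurable (ρ t) volume
  bounded : ∃ C : ℝ, ∀ t : ℝ, 0 ≤ t → ∀ᵐ x : Plane, |ρ t x| ≤ C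
  support : ∀ t : ℝ, 0 ≤ t → ∀ᵐ x : Plane, x ∉ Metric.closedBall (0 : Plane) 1 → ρ t x = 0
  equation : ∀ φ : Plane → ℝ, IsTestFunction φ → ∀ t : ℝ, 0 ≤ t →
    ∫ x in disk, ρ t x * φ x =
      (∫ x in disk, ρ₀ x * φ x) +
        ∫ s in (0 : ℝ)..t, ∫ x in disk, ρ s x * fderiv ℝ φ x (v x)

/-- The geometric mixing scale of `f` with accuracy `κ`: the infimum of all `ε > 0` such that
on every disk of radius `ε` the mean of `f` is at most `κ` times the sup norm of `f` on the unit
disk, in absolute value. It is `∞` if there is no such `ε`. -/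
def geometricMixingScale (κ : ℝ) (f : Plane → ℝ) : ℝ≥0∞ :=
  ⨅ (ε : ℝ) (_ : 0 < ε)
    (_ : ∀ x : Plane, ENNReal.ofReal |⨍ y in Metric.ball x ε, f y| ≤
      ENNReal.ofReal κ * eLpNorm f ∞ (volume.restrict disk)),
    ENNReal.ofReal ε

/-- `ξ` belongs to the Sobolev space `H¹` of the unit disk, with weak gradient `g`. -/
structure IsSobolevWithGradient (ξ : Plane → ℝ) (g : Plane → Plane) : Prop where
  memLp : MemLp ξ 2 (volume.restrict disk)
  memLp_gradient : MemLp g 2 (volume.restrict disk)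
  weak_gradient : ∀ φ : Plane → ℝ, IsTestFunction φ → ∀ i : Fin 2,
    ∫ x in disk, ξ x * fderiv ℝ φ x (EuclideanSpace.single i 1) = -∫ x in disk, g x i * φ x

/-- The homogeneous negative Sobolev (semi-)norm on the unit disk,
`sup {∫ f ξ : ‖∇ξ‖_{L²} ≤ 1}`, with values in `[0, ∞]`. The set of competitors is symmetric
under `ξ ↦ -ξ`, so negative integrals play no role in the supremum. -/
def negSobolevNorm (f : Plane → ℝ) : ℝ≥0∞ :=
  ⨆ (ξ : Plane → ℝ) (g : Plane → Plane) (_ : IsSobolevWithGradient ξ g)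
    (_ : eLpNorm g 2 (volume.restrict disk) ≤ 1),
    ENNReal.ofReal (∫ x in disk, f x * ξ x)

end DiskMixing

end

/-! Mixing by the radially sheared rotation of the unit disk. -/

noncomputable section

namespace DiskMixing

/-! The flow turns the circle of radius `r` at angular speed `-2πr`, so `ρ t` is the datum composed
with a `twist` whose shear parameter is `2πt`. Both mixing statements follow from one estimate:
pairings of the twisted datum with `ξ` tend to zero uniformly over all `ξ` with `‖∇ξ‖ ≤ 1` in `L²`
(`IsCircleMeanZero.exists_decay`).

Let `P a` be the pairing of `ξ` with the datum twisted with shear `t` and rotated further by `a`.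
Its mean over a full turn is zero, because circle averages vanish; it remains to show that `P` is
nearly constant. For smooth data supported off the origin, `a`-differentiation produces an angular
derivative. By `eulerDeriv_comp_twist` this is `1/t` times a radial derivative of the twisted
function, up to bounded terms, and the radial derivative is moved onto `ξ`; thus `P` varies by
`O(1/t)` (`IsAnnularTest.exists_decay`). General data are approximated in `L²`, the error being
controlled by `IsSobolevPair.abs_sub_le_of_memLp`. Every bound uses `∇ξ` only, so no normalisation
of the mean of `ξ` is needed.

Arbitrary weak solutions are reduced to the transported datum by duality with the flow
(`IsWeakSolution.ae_eq`). The geometric scale is treated by testing with translates of one bump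
function that approximates the indicator of a disk. -/

/-- The rotation by a right angle. -/
def perp : Plane →L[ℝ] Plane :=
  LinearMap.toContinuousLinearMap
    { toFun := fun x => !₂[-x 1, x 0]
      map_add' := fun x y => by ext i; fin_cases i <;> simp; ring
      map_smul' := fun c x => by ext i; fin_cases i <;> simp }

theorem perp_apply (x : Plane) : perp x = !₂[-x 1, x 0] := rfl

attribute [irreducible] perp

theorem perp_perp (x : Plane) : perp (perp x) = -x := by
  ext i; fin_cases i <;> simp [perp_apply]

theorem norm_sq_eq (x : Plane) : ‖x‖ ^ 2 = x 0 ^ 2 + x 1 ^ 2 := by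
  simp [EuclideanSpace.norm_sq_eq]

/-! ### Rotations and the twist maps -/

/-- The rotation by the angle `θ`. -/
def rot (θ : ℝ) (x : Plane) : Plane := Real.cos θ • x + Real.sin θ • perp x

theorem rot_zero (x : Plane) : rot 0 x = x := by simp [rot]

theorem rot_smul (θ c : ℝ) (x : Plane) : rot θ (c • x) = c • rot θ x := by
  simp only [rot, map_smul, smul_add, smul_comm c]

theorem rot_rot (a b : ℝ) (x : Plane) : rot a (rot b x) = rot (a + b) x := by
  simp only [rot, map_add, map_smul, perp_perp, Real.cos_add, Real.sin_add]
  module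

theorem norm_rot (θ : ℝ) (x : Plane) : ‖rot θ x‖ = ‖x‖ := by
  have : ‖rot θ x‖ ^ 2 = ‖x‖ ^ 2 := by
    rw [norm_sq_eq, norm_sq_eq]
    simp only [rot, perp_apply, PiLp.add_apply, PiLp.smul_apply, smul_eq_mul,
      Matrix.cons_val_zero, Matrix.cons_val_one]
    linear_combination (x 0 ^ 2 + x 1 ^ 2) * Real.sin_sq_add_cos_sq θ
  exact (sq_eq_sq₀ (norm_nonneg _) (norm_nonneg _)).1 this

theorem norm_perp (x : Plane) : ‖perp x‖ = ‖x‖ := by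
  simpa [rot] using norm_rot (Real.pi / 2) x

theorem rot_add_two_pi (θ : ℝ) (x : Plane) : rot (θ + 2 * Real.pi) x = rot θ x := by
  simp [rot]

theorem rot_polar (a r θ : ℝ) : rot a (polar r θ) = polar r (θ + a) := by
  ext i
  fin_cases i <;> simp [rot, perp_apply, polar, Real.cos_add, Real.sin_add] <;> ring

theorem norm_polar (r θ : ℝ) : ‖polar r θ‖ = |r| := by
  have : ‖polar r θ‖ ^ 2 = |r| ^ 2 := by
    rw [norm_sq_eq, sq_abs]
    simp only [polar, Matrix.cons_val_zero, Matrix.cons_val_one]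
    linear_combination r ^ 2 * Real.sin_sq_add_cos_sq θ
  exact (sq_eq_sq₀ (norm_nonneg _) (abs_nonneg _)).1 this

theorem exists_eq_polar (x : Plane) : ∃ θ, x = polar ‖x‖ θ := by
  refine ⟨Complex.arg ⟨x 0, x 1⟩, ?_⟩
  have h : ‖(⟨x 0, x 1⟩ : ℂ)‖ = ‖x‖ := by
    rw [← sq_eq_sq₀ (norm_nonneg _) (norm_nonneg _), norm_sq_eq, Complex.sq_norm,
      Complex.normSq_mk]
    ring
  ext i
  fin_cases i
  · simp [polar, ← h, Complex.norm_mul_cos_arg]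
  · simp [polar, ← h, Complex.norm_mul_sin_arg]

theorem hasDerivAt_rot (x : Plane) (θ : ℝ) :
    HasDerivAt (fun θ => rot θ x) (perp (rot θ x)) θ := by
  have h := ((Real.hasDerivAt_cos θ).smul_const x).add
    ((Real.hasDerivAt_sin θ).smul_const (perp x))
  have e : perp (rot θ x) = -Real.sin θ • x + Real.cos θ • perp x := by
    simp only [rot, map_add, map_smul, perp_perp]
    module
  rw [e]
  exact h

/-- The map that rotates the circle of radius `r` centered at the origin by the angle
`a + t * r`. -/
def twist (a t : ℝ) (x : Plane) : Plane := rot (a + t * ‖x‖) x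

theorem norm_twist (a t : ℝ) (x : Plane) : ‖twist a t x‖ = ‖x‖ := norm_rot _ _

theorem twist_twist (a b s t : ℝ) (x : Plane) :
    twist a s (twist b t x) = twist (a + b) (s + t) x := by
  rw [twist, norm_twist, twist, twist, rot_rot]
  congr 1; ring

theorem twist_zero_zero (x : Plane) : twist 0 0 x = x := by simp [twist, rot_zero]

theorem twist_two_pi (t : ℝ) (x : Plane) : twist (2 * Real.pi) t x = twist 0 t x := by
  rw [twist, add_comm, rot_add_two_pi, twist, zero_add]

@[fun_prop]
theorem continuous_twist {X : Type*} [TopologicalSpace X] {a t : X → ℝ} {f : X → Plane}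
    (ha : Continuous a) (ht : Continuous t) (hf : Continuous f) :
    Continuous fun y => twist (a y) (t y) (f y) := by
  unfold twist rot
  fun_prop

/-- The twist map as a homeomorphism. -/
def twistHomeo (a t : ℝ) : Plane ≃ₜ Plane where
  toFun := twist a t
  invFun := twist (-a) (-t)
  left_inv x := by simp [twist_twist, twist_zero_zero]
  right_inv x := by simp [twist_twist, twist_zero_zero]
  continuous_toFun := continuous_twist continuous_const continuous_const continuous_id
  continuous_invFun := continuous_twist continuous_const continuous_const continuous_id

/-- The angle involves `‖x‖`, which is not smooth at the origin. This is why test functions on the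
punctured disk are used below. -/
theorem contDiffAt_twist (a t : ℝ) {x : Plane} (hx : x ≠ 0) : ContDiffAt ℝ ∞ (twist a t) x := by
  have hn : ContDiffAt ℝ ∞ (fun y : Plane => ‖y‖) x := contDiffAt_norm ℝ hx
  unfold twist rot
  have hp : ContDiffAt ℝ ∞ (fun y : Plane => perp y) x := perp.contDiff.contDiffAt
  fun_prop

theorem hasDerivAt_twist_left (t : ℝ) (x : Plane) (a : ℝ) :
    HasDerivAt (fun a => twist a t x) (perp (twist a t x)) a := by
  have := (hasDerivAt_rot x (a + t * ‖x‖)).scomp a ((hasDerivAt_id a).add_const (t * ‖x‖))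
  simpa [Function.comp_def, twist] using this

theorem hasDerivAt_twist_right (a : ℝ) (x : Plane) (t : ℝ) :
    HasDerivAt (fun t => twist a t x) (‖x‖ • perp (twist a t x)) t := by
  have := (hasDerivAt_rot x (a + t * ‖x‖)).scomp t
    (((hasDerivAt_id t).mul_const ‖x‖).const_add a)
  simpa [Function.comp_def, twist] using this

/-! ### Measure -/

theorem measurable_polar : Measurable fun p : ℝ × ℝ => polar p.1 p.2 := by
  have : Continuous fun p : ℝ × ℝ => polar p.1 p.2 := by
    unfold polar
    refine (PiLp.continuous_toLp 2 _).comp (continuous_pi fun i => ?_)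
    fin_cases i <;> simp <;> fun_prop
  exact this.measurable

/-- Polar coordinates on `ℂ`, carried over by the isometry that comes with
`Complex.orthonormalBasisOneI`. -/
theorem lintegral_polar (f : Plane → ℝ≥0∞) :
    ∫⁻ x, f x = ∫⁻ p in polarCoord.target, ENNReal.ofReal p.1 * f (polar p.1 p.2) := by
  have hmp := Complex.orthonormalBasisOneI.repr.measurePreserving
  rw [← hmp.lintegral_comp_emb
    Complex.orthonormalBasisOneI.repr.toHomeomorph.measurableEmbedding,
    ← Complex.lintegral_comp_polarCoord_symm]
  refine lintegral_congr fun p => ?_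
  rw [smul_eq_mul]
  congr 2

theorem lintegral_polar_iterated {f : Plane → ℝ≥0∞} (hf : Measurable f) :
    ∫⁻ x, f x = ∫⁻ r in Ioi (0 : ℝ), ENNReal.ofReal r *
      ∫⁻ θ in Ioc (-Real.pi) (-Real.pi + 2 * Real.pi), f (polar r θ) := by
  have hp : Measurable fun p : ℝ × ℝ => polar p.1 p.2 := measurable_polar
  have hm : Measurable fun p : ℝ × ℝ => f (polar p.1 p.2) := hf.comp hp
  have hm' : Measurable fun p : ℝ × ℝ => ENNReal.ofReal p.1 * f (polar p.1 p.2) :=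
    (ENNReal.measurable_ofReal.comp measurable_fst).mul hm
  rw [lintegral_polar, polarCoord_target, Measure.volume_eq_prod, ← Measure.prod_restrict,
    lintegral_prod _ hm'.aemeasurable]
  refine lintegral_congr fun r => ?_
  have hr : Measurable fun θ : ℝ => f (polar r θ) := hm.comp measurable_prodMk_left
  dsimp only
  rw [lintegral_const_mul _ hr,
    show -Real.pi + 2 * Real.pi = Real.pi by ring, setLIntegral_congr Ioo_ae_eq_Ioc]

theorem setLIntegral_Ioc_periodic_add {T : ℝ} (hT : 0 < T) {g : ℝ → ℝ≥0∞} (hg : g.Periodic T)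
    (b c : ℝ) : ∫⁻ θ in Ioc b (b + T), g (θ + c) = ∫⁻ θ in Ioc b (b + T), g θ := by
  have h1 : ∫⁻ θ in Ioc b (b + T), g (θ + c) = ∫⁻ θ in Ioc (b + c) (b + c + T), g θ := by
    rw [← (measurePreserving_add_right volume c).setLIntegral_comp_preimage_emb
      (measurableEmbedding_addRight c) g]
    simp [add_right_comm]
  rw [h1]
  refine (isAddFundamentalDomain_Ioc hT (b + c)).setLIntegral_eq
    (isAddFundamentalDomain_Ioc hT b) g ?_
  rintro ⟨v, hv⟩ x
  obtain ⟨n, rfl⟩ := AddSubgroup.mem_zmultiples_iff.1 hv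
  change g (n • T + x) = g x
  rw [add_comm]
  exact hg.zsmul n x

/-- In polar coordinates the twist shifts the angle by a constant on each circle, which leaves the
integral of a periodic function over a period unchanged. -/
theorem measurePreserving_twist (a t : ℝ) : MeasurePreserving (twist a t) := by
  have hc : Continuous fun x => twist a t x := by fun_prop
  refine ⟨hc.measurable, ?_⟩
  refine Measure.ext_of_lintegral _ fun f hf => ?_
  rw [lintegral_map hf hc.measurable,
    lintegral_polar_iterated (f := fun x => f (twist a t x)) (hf.comp hc.measurable),
    lintegral_polar_iterated hf]
  refine lintegral_congr fun r => ?_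
  congr 1
  have : ∀ θ, twist a t (polar r θ) = polar r (θ + (a + t * |r|)) := fun θ => by
    rw [twist, norm_polar, rot_polar]
  simp_rw [this]
  refine setLIntegral_Ioc_periodic_add (g := fun θ => f (polar r θ)) Real.two_pi_pos
    (fun θ => ?_) _ _
  simp [polar]

theorem measurableEmbedding_twist (a t : ℝ) : MeasurableEmbedding (twist a t) :=
  (twistHomeo a t).measurableEmbedding

/-- Null sets of radii give null sets in the plane. -/
theorem ae_norm_of_ae_pos {P : ℝ → Prop} (h : ∀ᵐ r : ℝ, 0 < r → P r) :
    ∀ᵐ x : Plane, x ≠ 0 → P ‖x‖ := by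
  obtain ⟨N, hN, hNm, hN0⟩ := exists_measurable_superset_of_null h
  have hm : MeasurableSet {x : Plane | ‖x‖ ∈ N} := measurable_norm hNm
  have h0 : volume {x : Plane | ‖x‖ ∈ N} = 0 := by
    rw [← lintegral_indicator_one hm, lintegral_polar_iterated (measurable_one.indicator hm)]
    refine (lintegral_congr_ae (g := 0) ?_).trans (lintegral_zero)
    have : ∀ᵐ r : ℝ, r ∉ N := measure_eq_zero_iff_ae_notMem.1 hN0
    filter_upwards [ae_restrict_of_ae this, ae_restrict_mem measurableSet_Ioi] with r hr hr0
    have hz : ∀ θ, ({x : Plane | ‖x‖ ∈ N}.indicator (1 : Plane → ℝ≥0∞)) (polar r θ) = 0 := by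
      intro θ
      refine indicator_of_notMem ?_ _
      rw [mem_ofPred_eq, norm_polar, abs_of_pos hr0]
      exact hr
    simp [hz]
  filter_upwards [measure_eq_zero_iff_ae_notMem.1 h0] with x hx hx0
  by_contra hP
  exact hx (hN fun hc => hP (hc (norm_pos_iff.2 hx0)))

/-! ### Test functions on the punctured disk -/

/-- Smooth functions with compact support inside the punctured open unit disk. -/
structure IsAnnularTest (φ : Plane → ℝ) : Prop where
  contDiff : ContDiff ℝ ∞ φ
  hasCompactSupport : HasCompactSupport φ
  tsupport_subset : tsupport φ ⊆ disk \ {0}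

theorem contDiff_of_tsupport {f : Plane → ℝ} (hf : ∀ x ∈ tsupport f, ContDiffAt ℝ ∞ f x) :
    ContDiff ℝ ∞ f :=
  contMDiff_iff_contDiff.1 <| contMDiff_of_tsupport fun x hx =>
    contMDiffAt_iff_contDiffAt.2 (hf x hx)

theorem zero_notMem_of_subset {s : Set Plane} (h : s ⊆ disk \ {0}) : (0 : Plane) ∉ s :=
  fun h0 => (h h0).2 rfl

namespace IsAnnularTest

variable {φ ψ : Plane → ℝ}

theorem isTestFunction (h : IsAnnularTest φ) : IsTestFunction φ :=
  ⟨h.contDiff, h.hasCompactSupport, h.tsupport_subset.trans sdiff_subset⟩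

theorem differentiable (h : IsAnnularTest φ) : Differentiable ℝ φ :=
  h.contDiff.differentiable (by simp)

theorem continuous (h : IsAnnularTest φ) : Continuous φ := h.contDiff.continuous

theorem memLp (h : IsAnnularTest φ) (p : ℝ≥0∞) : MemLp φ p volume :=
  h.continuous.memLp_of_hasCompactSupport h.hasCompactSupport

theorem eq_zero (h : IsAnnularTest φ) {x : Plane} (hx : x ∉ disk) : φ x = 0 :=
  image_eq_zero_of_notMem_tsupport fun hx' => hx (h.tsupport_subset hx').1

/-- The support stays away from the origin, so factors that are singular there, such as `‖x‖⁻¹`, are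
harmless. -/
theorem of_tsupport_subset (h : IsAnnularTest φ) (hψ : tsupport ψ ⊆ tsupport φ)
    (hs : ∀ x, x ≠ 0 → ContDiffAt ℝ ∞ ψ x) : IsAnnularTest ψ where
  contDiff := by
    refine contDiff_of_tsupport fun x hx => hs x ?_
    rintro rfl
    exact zero_notMem_of_subset h.tsupport_subset (hψ hx)
  hasCompactSupport := h.hasCompactSupport.of_isClosed_subset (isClosed_tsupport _) hψ
  tsupport_subset := hψ.trans h.tsupport_subset

theorem mul_left (h : IsAnnularTest φ) {c : Plane → ℝ}
    (hc : ∀ x, x ≠ 0 → ContDiffAt ℝ ∞ c x) : IsAnnularTest fun x => c x * φ x :=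
  h.of_tsupport_subset (tsupport_mul_subset_right) fun x hx =>
    (hc x hx).mul h.contDiff.contDiffAt

theorem add (h : IsAnnularTest φ) (h' : IsAnnularTest ψ) : IsAnnularTest fun x => φ x + ψ x where
  contDiff := h.contDiff.add h'.contDiff
  hasCompactSupport := h.hasCompactSupport.add h'.hasCompactSupport
  tsupport_subset := (tsupport_add φ ψ).trans (union_subset h.tsupport_subset h'.tsupport_subset)

theorem fderiv_apply (h : IsAnnularTest φ) {v : Plane → Plane}
    (hv : ∀ x, x ≠ 0 → ContDiffAt ℝ ∞ v x) : IsAnnularTest fun x => fderiv ℝ φ x (v x) := by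
  refine h.of_tsupport_subset ?_ fun x hx => ?_
  · refine closure_minimal (fun x hx => ?_) (isClosed_tsupport _)
    by_contra h'
    refine hx ?_
    have : fderiv ℝ φ x = 0 := image_eq_zero_of_notMem_tsupport fun hc =>
      h' (tsupport_fderiv_subset ℝ hc)
    simp [this]
  · exact (h.contDiff.fderiv_right (m := ∞) (by simp)).contDiffAt.clm_apply (hv x hx)

theorem comp_twist (h : IsAnnularTest φ) (a t : ℝ) : IsAnnularTest fun x => φ (twist a t x) := by
  have hts : tsupport (fun x => φ (twist a t x)) ⊆ twist a t ⁻¹' tsupport φ :=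
    closure_minimal (fun x hx => subset_tsupport φ hx)
      ((isClosed_tsupport φ).preimage (by fun_prop : Continuous fun x => twist a t x))
  have hmem : ∀ x, x ∈ twist a t ⁻¹' tsupport φ → x ∈ disk \ {0} := fun x hx => by
    have := h.tsupport_subset hx
    simpa only [disk, Set.mem_sdiff, mem_ball_zero_iff, norm_twist, mem_singleton_iff,
      ← norm_eq_zero (a := twist a t x), ← norm_eq_zero (a := x)] using this
  refine ⟨contDiff_of_tsupport fun x hx => ?_, ?_, hts.trans hmem⟩
  · exact h.contDiff.contDiffAt.comp x (contDiffAt_twist a t (hmem x (hts hx)).2)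
  · exact h.hasCompactSupport.comp_homeomorph (twistHomeo a t)

end IsAnnularTest

/-! ### Angular and radial derivatives of twisted functions -/

/-- The angular derivative. -/
def angularDeriv (φ : Plane → ℝ) (x : Plane) : ℝ := fderiv ℝ φ x (perp x)

/-- The Euler operator `r ∂ᵣ`. -/
def eulerDeriv (φ : Plane → ℝ) (x : Plane) : ℝ := fderiv ℝ φ x x

variable {φ : Plane → ℝ}

theorem IsAnnularTest.angularDeriv (h : IsAnnularTest φ) : IsAnnularTest (angularDeriv φ) :=
  h.fderiv_apply fun _ _ => perp.contDiff.contDiffAt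

theorem IsAnnularTest.eulerDeriv (h : IsAnnularTest φ) : IsAnnularTest (eulerDeriv φ) :=
  h.fderiv_apply fun _ _ => contDiffAt_id

theorem hasDerivAt_comp_twist_left (h : Differentiable ℝ φ) (t : ℝ) (x : Plane) (a : ℝ) :
    HasDerivAt (fun a => φ (twist a t x)) (angularDeriv φ (twist a t x)) a :=
  (h _).hasFDerivAt.comp_hasDerivAt a (hasDerivAt_twist_left t x a)

theorem hasDerivAt_comp_twist_right (h : Differentiable ℝ φ) (a : ℝ) (x : Plane) (t : ℝ) :
    HasDerivAt (fun t => φ (twist a t x)) (‖x‖ * angularDeriv φ (twist a t x)) t := by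
  have := (h _).hasFDerivAt.comp_hasDerivAt t (hasDerivAt_twist_right a x t)
  simpa [angularDeriv] using! this

/-- Rotations commute with twists. -/
theorem angularDeriv_comp_twist (h : IsAnnularTest φ) (a t : ℝ) (x : Plane) :
    angularDeriv (fun x => φ (twist a t x)) x = angularDeriv φ (twist a t x) := by
  have h1 := hasDerivAt_comp_twist_left (h.comp_twist a t).differentiable 0 x 0
  have h2 := hasDerivAt_comp_twist_left h.differentiable t x (a + 0)
  have h3 := h2.comp_const_add a 0
  simp only [twist_twist, twist_zero_zero, add_zero] at h1 h3
  exact h1.unique h3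

/-- For `c > 0`, twisting `c • x` with shear `t` is `c` times twisting `x` with shear `c * t`;
differentiate at `c = 1`. The shear enters here as the large factor `t` in front of the angular
derivative. -/
theorem eulerDeriv_comp_twist (h : IsAnnularTest φ) (a t : ℝ) (x : Plane) :
    eulerDeriv (fun x => φ (twist a t x)) x =
      eulerDeriv φ (twist a t x) + t * (‖x‖ * angularDeriv φ (twist a t x)) := by
  have hl : HasDerivAt (fun c : ℝ => c • x) x 1 := by
    simpa using (hasDerivAt_id (1 : ℝ)).smul_const x
  have h1 : HasDerivAt (fun c : ℝ => φ (twist a t (c • x)))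
      (eulerDeriv (fun x => φ (twist a t x)) x) 1 := by
    have := ((h.comp_twist a t).differentiable ((1 : ℝ) • x)).hasFDerivAt.comp_hasDerivAt 1 hl
    simpa [eulerDeriv] using! this
  have h2 : HasDerivAt (fun c : ℝ => c • twist a (c * t) x)
      (twist a t x + (t * ‖x‖) • perp (twist a t x)) 1 := by
    have h3 : HasDerivAt (fun c : ℝ => twist a (c * t) x) (t • ‖x‖ • perp (twist a (1 * t) x)) 1 := by
      have h4 : HasDerivAt (fun c : ℝ => c * t) t 1 := by
        simpa using (hasDerivAt_id (1 : ℝ)).mul_const t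
      exact (hasDerivAt_twist_right a x (1 * t)).scomp 1 h4
    have := (hasDerivAt_id (1 : ℝ)).smul h3
    simpa [smul_smul, add_comm] using! this
  have h3 : HasDerivAt (fun c : ℝ => φ (c • twist a (c * t) x))
      (fderiv ℝ φ (twist a t x) (twist a t x + (t * ‖x‖) • perp (twist a t x))) 1 := by
    have := (h.differentiable ((1 : ℝ) • twist a (1 * t) x)).hasFDerivAt.comp_hasDerivAt 1 h2
    simpa using! this
  have h4 : (fun c : ℝ => φ (twist a t (c • x))) =ᶠ[𝓝 1] fun c => φ (c • twist a (c * t) x) := by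
    filter_upwards [lt_mem_nhds one_pos] with c hc
    rw [twist, norm_smul, Real.norm_of_nonneg hc.le, rot_smul, twist]
    congr 3; ring
  rw [(h1.congr_of_eventuallyEq h4.symm).unique h3]
  simp [eulerDeriv, angularDeriv, mul_assoc]

/-! ### The disk, and approximation by annular test functions -/

theorem setIntegral_disk_eq {f : Plane → ℝ} (hf : ∀ x, x ∉ disk → f x = 0) :
    ∫ x in disk, f x = ∫ x, f x :=
  setIntegral_eq_integral_of_forall_compl_eq_zero hf

theorem measurableSet_disk : MeasurableSet disk := measurableSet_ball

theorem twist_mem_disk {a t : ℝ} {x : Plane} : twist a t x ∈ disk ↔ x ∈ disk := by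
  simp [disk, norm_twist]

instance : IsFiniteMeasure (volume.restrict disk) :=
  ⟨by simp [disk]⟩

theorem memLp_indicator_disk {f : Plane → ℝ} {p : ℝ≥0∞} (hf : MemLp f ⊤ volume)
    (h0 : ∀ x, x ∉ disk → f x = 0) : MemLp f p volume := by
  have h1 : MemLp f p (volume.restrict disk) := (hf.restrict disk).mono_exponent le_top
  rw [← memLp_indicator_iff_restrict measurableSet_disk] at h1
  rwa [indicator_eq_self.2 (fun x hx => by_contra fun hd => hx (h0 x hd))] at h1

/-- Bounded functions supported in the disk are approximated in `L²` by test functions of the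
punctured disk. -/
theorem exists_isAnnularTest_eLpNorm_sub_le {f : Plane → ℝ} (hf : MemLp f 2 volume)
    (h0 : ∀ x, x ∉ disk → f x = 0) {ε : ℝ} (hε : 0 < ε) :
    ∃ φ, IsAnnularTest φ ∧ eLpNorm (f - φ) 2 volume ≤ ENNReal.ofReal ε := by
  have hε2 : 0 < ε / 2 := by positivity
  obtain ⟨δ, hδ, hδf⟩ := hf.eLpNorm_indicator_le one_le_two ENNReal.ofNat_ne_top hε2
  have hU : IsOpen (disk \ {0} : Set Plane) := Metric.isOpen_ball.sdiff isClosed_singleton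
  have hUfin : volume (disk \ {0} : Set Plane) ≠ ⊤ :=
    ((measure_mono sdiff_subset).trans_lt measure_ball_lt_top).ne
  obtain ⟨K, hKU, hK, hKm⟩ := hU.measurableSet.exists_isCompact_sdiff_lt hUfin
    (ENNReal.ofReal_pos.2 hδ).ne'
  obtain ⟨L, hL, hKL, hLU⟩ := exists_compact_between hK hU hKU
  obtain ⟨χ, hχ, hχr, hχs, hχ1⟩ := exists_contMDiff_support_eq_eq_one_iff
    (n := ⊤) (modelWithCornersSelf ℝ Plane) isOpen_interior hK.isClosed hKL
  have hχ' : ContDiff ℝ ∞ χ := contMDiff_iff_contDiff.1 hχ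
  have hχt : tsupport χ ⊆ L := by
    rw [tsupport, hχs]
    exact closure_minimal interior_subset hL.isClosed
  have hχc : HasCompactSupport χ := hL.of_isClosed_subset (isClosed_tsupport _) hχt
  obtain ⟨φ, -, hφ, hφf⟩ := (hf.indicator hK.measurableSet).exist_eLpNorm_sub_le
    ENNReal.ofNat_ne_top one_le_two hε2
  have hφK : AEStronglyMeasurable (K.indicator f - φ) volume :=
    (hf.1.indicator hK.measurableSet).sub hφ.continuous.aestronglyMeasurable
  refine ⟨fun x => χ x * φ x, ⟨hχ'.mul hφ, hχc.mul_right,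
    (tsupport_mul_subset_left).trans (hχt.trans hLU)⟩, ?_⟩
  -- Since `χ = 1` on `K`, multiplying `K.indicator f` by `χ` changes nothing. The first term is
  -- small because `disk \ K` has measure at most `δ`, the second because `0 ≤ χ ≤ 1`.
  have hdec : f - (fun x => χ x * φ x) =
      (disk \ K).indicator f + fun x => χ x * (K.indicator f - φ) x := by
    ext x
    by_cases hxK : x ∈ K
    · simp [hxK, (hχ1 x).1 hxK]
    · by_cases hxd : x ∈ disk
      · simp [hxK, hxd, sub_eq_add_neg]
      · simp [hxK, hxd, h0 x hxd]
  have hm : volume (disk \ K) ≤ ENNReal.ofReal δ := by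
    refine le_trans ?_ hKm.le
    rw [sdiff_right_comm, measure_sdiff_null (measure_singleton _)]
  have h1 := hδf _ (measurableSet_disk.diff hK.measurableSet) hm
  have h2 : eLpNorm (fun x => χ x * (K.indicator f - φ) x) 2 volume ≤ ENNReal.ofReal (ε / 2) := by
    refine (eLpNorm_mono fun x => ?_).trans hφf
    have := hχr (mem_range_self x)
    rw [norm_mul, Real.norm_of_nonneg this.1]
    exact mul_le_of_le_one_left (norm_nonneg _) this.2
  rw [hdec]
  calc _ ≤ _ := eLpNorm_add_le (hf.1.indicator (measurableSet_disk.diff hK.measurableSet))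
          (hχ'.continuous.aestronglyMeasurable.mul hφK) one_le_two
    _ ≤ ENNReal.ofReal (ε / 2) + ENNReal.ofReal (ε / 2) := add_le_add h1 h2
    _ = ENNReal.ofReal ε := by rw [← ENNReal.ofReal_add hε2.le hε2.le, add_halves]

/-! ### Square-integrable functions -/

/-- The `L²` norm on the plane as a real number. -/
def l2norm {E : Type*} [NormedAddCommGroup E] (f : Plane → E) : ℝ := (eLpNorm f 2 volume).toReal

theorem l2norm_nonneg {E : Type*} [NormedAddCommGroup E] (f : Plane → E) : 0 ≤ l2norm f :=
  ENNReal.toReal_nonneg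

theorem abs_integral_le_eLpNorm_mul {α E E' : Type*} [MeasurableSpace α] {μ : Measure α}
    [NormedAddCommGroup E] [NormedAddCommGroup E']
    {f : α → E} {g : α → E'} (hf : MemLp f 2 μ) (hg : MemLp g 2 μ)
    {F : α → ℝ} (hF : ∀ x, |F x| ≤ ‖f x‖ * ‖g x‖) :
    |∫ x, F x ∂μ| ≤ (eLpNorm f 2 μ).toReal * (eLpNorm g 2 μ).toReal := by
  have hmem : MemLp (fun x => ‖f x‖ * ‖g x‖) 1 μ := hg.norm.mul hf.norm
  have hsm : eLpNorm ((fun x => ‖f x‖) • fun x => ‖g x‖) 1 μ ≤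
      eLpNorm (fun x => ‖f x‖) 2 μ * eLpNorm (fun x => ‖g x‖) 2 μ :=
    eLpNorm_smul_le_mul_eLpNorm hg.norm.1 hf.norm.1
  have hle : ‖∫ x, F x ∂μ‖ ≤ ∫ x, ‖f x‖ * ‖g x‖ ∂μ :=
    norm_integral_le_of_norm_le (memLp_one_iff_integrable.1 hmem)
      (Eventually.of_forall fun x => hF x)
  calc |∫ x, F x ∂μ| ≤ ∫ x, ‖f x‖ * ‖g x‖ ∂μ := hle
    _ = ∫ x, ‖‖f x‖ * ‖g x‖‖ ∂μ := by simp
    _ = (eLpNorm (fun x => ‖f x‖ * ‖g x‖) 1 μ).toReal := by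
        rw [integral_norm_eq_lintegral_enorm hmem.1, eLpNorm_one_eq_lintegral_enorm]
    _ ≤ (eLpNorm (fun x => ‖f x‖) 2 μ * eLpNorm (fun x => ‖g x‖) 2 μ).toReal := by
        refine ENNReal.toReal_mono (ENNReal.mul_ne_top hf.norm.eLpNorm_ne_top
          hg.norm.eLpNorm_ne_top) ?_
        exact hsm
    _ = _ := by rw [ENNReal.toReal_mul, eLpNorm_norm, eLpNorm_norm]

theorem abs_integral_le_l2norm_mul {E E' : Type*} [NormedAddCommGroup E] [NormedAddCommGroup E']
    {f : Plane → E} {g : Plane → E'} (hf : MemLp f 2 volume) (hg : MemLp g 2 volume)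
    {F : Plane → ℝ} (hF : ∀ x, |F x| ≤ ‖f x‖ * ‖g x‖) : |∫ x, F x| ≤ l2norm f * l2norm g :=
  abs_integral_le_eLpNorm_mul hf hg hF

theorem l2norm_comp_twist {f : Plane → ℝ} (hf : AEStronglyMeasurable f volume) (a t : ℝ) :
    l2norm (fun x => f (twist a t x)) = l2norm f :=
  congrArg ENNReal.toReal (eLpNorm_comp_measurePreserving hf (measurePreserving_twist a t))

theorem MemLp.comp_twist {f : Plane → ℝ} {p : ℝ≥0∞} (hf : MemLp f p volume) (a t : ℝ) :
    MemLp (fun x => f (twist a t x)) p volume :=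
  hf.comp_measurePreserving (measurePreserving_twist a t)

/-! ### Fubini for pairings that depend on a parameter -/

section Swap

variable {ξ : Plane → ℝ} {h : ℝ → Plane → ℝ} {C : ℝ}

theorem integrable_prod_mul (hξ : Integrable ξ)
    (hm : StronglyMeasurable (Function.uncurry h)) (hC : ∀ s x, |h s x| ≤ C) (a b : ℝ) :
    Integrable (Function.uncurry fun s x => ξ x * h s x)
      ((volume.restrict (Ioc a b)).prod volume) := by
  have h1 : Integrable (fun p : ℝ × Plane => ξ p.2) ((volume.restrict (Ioc a b)).prod volume) :=
    hξ.comp_snd _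
  exact h1.mul_bdd (c := C) hm.aestronglyMeasurable (Eventually.of_forall fun p => hC p.1 p.2)

theorem intervalIntegrable_integral_mul (hξ : Integrable ξ)
    (hm : StronglyMeasurable (Function.uncurry h)) (hC : ∀ s x, |h s x| ≤ C) {a b : ℝ}
    (hab : a ≤ b) : IntervalIntegrable (fun s => ∫ x, ξ x * h s x) volume a b := by
  rw [intervalIntegrable_iff_integrableOn_Ioc_of_le hab]
  exact (integrable_prod_mul hξ hm hC a b).integral_prod_left

theorem intervalIntegral_integral_mul_swap (hξ : Integrable ξ)
    (hm : StronglyMeasurable (Function.uncurry h)) (hC : ∀ s x, |h s x| ≤ C) {a b : ℝ}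
    (hab : a ≤ b) :
    ∫ s in a..b, ∫ x, ξ x * h s x = ∫ x, ξ x * ∫ s in a..b, h s x := by
  simp only [intervalIntegral.integral_of_le hab, ← integral_const_mul]
  exact integral_integral_swap (integrable_prod_mul hξ hm hC a b)

end Swap

/-! ### Sobolev functions and rotations -/

/-- `ξ` is square-integrable and integrable on the plane with square-integrable weak gradient `g`
on the disk. -/
structure IsSobolevPair (ξ : Plane → ℝ) (g : Plane → Plane) : Prop where
  memLp : MemLp ξ 2 volume
  integrable : Integrable ξ
  memLp_gradient : MemLp g 2 volume
  weak_gradient : ∀ φ : Plane → ℝ, IsTestFunction φ → ∀ i : Fin 2,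
    ∫ x, ξ x * fderiv ℝ φ x (EuclideanSpace.single i 1) = -∫ x, g x i * φ x

theorem IsTestFunction.eq_zero {φ : Plane → ℝ} (h : IsTestFunction φ) {x : Plane}
    (hx : x ∉ disk) : φ x = 0 :=
  image_eq_zero_of_notMem_tsupport fun hx' => hx (h.2.2 hx')

theorem IsTestFunction.fderiv_eq_zero {φ : Plane → ℝ} (h : IsTestFunction φ) {x : Plane}
    (hx : x ∉ disk) : fderiv ℝ φ x = 0 :=
  image_eq_zero_of_notMem_tsupport fun hx' => hx (h.2.2 (tsupport_fderiv_subset ℝ hx'))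

/-- Extension by zero permits measure-preserving changes of variables on the whole plane. A jump
across the unit circle does not matter, as the weak gradient is tested only inside the disk. -/
theorem IsSobolevWithGradient.isSobolevPair {ξ : Plane → ℝ} {g : Plane → Plane}
    (h : IsSobolevWithGradient ξ g) : IsSobolevPair (disk.indicator ξ) (disk.indicator g) where
  memLp := (memLp_indicator_iff_restrict measurableSet_disk).2 h.memLp
  integrable := (integrable_indicator_iff measurableSet_disk).2 (h.memLp.integrable one_le_two)
  memLp_gradient := (memLp_indicator_iff_restrict measurableSet_disk).2 h.memLp_gradient
  weak_gradient φ hφ i := by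
    have := h.weak_gradient φ hφ i
    rw [← integral_indicator measurableSet_disk, ← integral_indicator measurableSet_disk] at this
    have h1 : ∀ x, disk.indicator ξ x * fderiv ℝ φ x (EuclideanSpace.single i 1) =
        disk.indicator (fun x => ξ x * fderiv ℝ φ x (EuclideanSpace.single i 1)) x := fun x => by
      by_cases hx : x ∈ disk <;> simp [hx]
    have h2 : ∀ x, disk.indicator g x i * φ x = disk.indicator (fun x => g x i * φ x) x :=
      fun x => by by_cases hx : x ∈ disk <;> simp [hx]
    simp only [h1, h2]
    exact this

/-! ### Integration by parts along linear vector fields -/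

variable {ξ : Plane → ℝ} {g : Plane → Plane} {φ : Plane → ℝ}

theorem plane_eq_sum (v : Plane) :
    v = v 0 • EuclideanSpace.single 0 (1 : ℝ) + v 1 • EuclideanSpace.single 1 (1 : ℝ) := by
  ext i; fin_cases i <;> simp

theorem abs_sum_mul_le (u v : Plane) : |u 0 * v 0 + u 1 * v 1| ≤ ‖u‖ * ‖v‖ := by
  have := abs_real_inner_le_norm u v
  simpa [PiLp.inner_apply, mul_comm] using this

/-- The weak form of `∫ ξ div (φ A) = -∫ φ ∇ξ ⬝ A` for a linear vector field `A`. -/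
theorem IsSobolevPair.abs_integral_mul_div_le (h : IsSobolevPair ξ g) (hφ : IsAnnularTest φ)
    (A : Plane →L[ℝ] Plane) (hA : ∀ x, ‖A x‖ ≤ ‖x‖) :
    |∫ x, ξ x * (fderiv ℝ φ x (A x) + (A (EuclideanSpace.single 0 1) 0 +
      A (EuclideanSpace.single 1 1) 1) * φ x)| ≤ l2norm φ * l2norm g := by
  -- The `i`-th weak derivative is tested with `A_i φ`; summing over `i` produces the trace of `A`
  -- as zeroth-order coefficient.
  let c : Fin 2 → Plane →L[ℝ] ℝ := fun i => (EuclideanSpace.proj i).comp A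
  have hc : ∀ i x, c i x = A x i := fun i x => rfl
  have ht : ∀ i, IsAnnularTest fun x => c i x * φ x := fun i =>
    hφ.mul_left fun x _ => (c i).contDiff.contDiffAt
  have hd : ∀ i x, fderiv ℝ (fun x => c i x * φ x) x (EuclideanSpace.single i 1) =
      A x i * fderiv ℝ φ x (EuclideanSpace.single i 1) +
        A (EuclideanSpace.single i 1) i * φ x := by
    intro i x
    have := ((c i).hasFDerivAt (x := x)).mul (hφ.differentiable x).hasFDerivAt
    rw [HasFDerivAt.fderiv (f := fun x => c i x * φ x) this]
    simp [hc, mul_comm]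
  have hi : ∀ i, Integrable fun x => ξ x * fderiv ℝ (fun x => c i x * φ x) x
      (EuclideanSpace.single i 1) := fun i =>
    h.memLp.integrable_mul (((ht i).fderiv_apply fun x _ => contDiffAt_const).memLp 2)
  have hg : ∀ i, MemLp (fun x => g x i) 2 volume := fun i =>
    (EuclideanSpace.proj (𝕜 := ℝ) i).comp_memLp' h.memLp_gradient
  have hi' : ∀ i, Integrable fun x => g x i * (c i x * φ x) := fun i =>
    (hg i).integrable_mul ((ht i).memLp 2)
  have key : ∫ x, ξ x * (fderiv ℝ φ x (A x) + (A (EuclideanSpace.single 0 1) 0 +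
      A (EuclideanSpace.single 1 1) 1) * φ x) =
      -∫ x, (g x 0 * (c 0 x * φ x) + g x 1 * (c 1 x * φ x)) := by
    rw [integral_add (hi' 0) (hi' 1), neg_add, ← h.weak_gradient _ (ht 0).isTestFunction 0,
      ← h.weak_gradient _ (ht 1).isTestFunction 1, ← integral_add (hi 0) (hi 1)]
    refine integral_congr_ae (Eventually.of_forall fun x => ?_)
    simp only [hd]
    conv_lhs => rw [plane_eq_sum (A x)]
    simp only [map_add, map_smul, smul_eq_mul]
    ring
  rw [key, abs_neg]
  refine abs_integral_le_l2norm_mul (hφ.memLp 2) h.memLp_gradient fun x => ?_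
  by_cases hx : x ∈ disk
  · have h1 : ‖A x‖ ≤ 1 := (hA x).trans (mem_ball_zero_iff.1 hx).le
    have h2 := abs_sum_mul_le (g x) (A x)
    calc _ = |φ x| * |g x 0 * A x 0 + g x 1 * A x 1| := by
          rw [← abs_mul]; congr 1; simp only [hc]; ring
      _ ≤ |φ x| * (‖g x‖ * 1) := by gcongr; exact h2.trans (by gcongr)
      _ = _ := by simp
  · simp [hφ.eq_zero hx]

/-- `perp` has trace zero, so no zeroth-order term occurs. -/
theorem IsSobolevPair.abs_integral_mul_angularDeriv_le (h : IsSobolevPair ξ g)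
    (hφ : IsAnnularTest φ) : |∫ x, ξ x * angularDeriv φ x| ≤ l2norm φ * l2norm g := by
  have := h.abs_integral_mul_div_le hφ perp fun x => (norm_perp x).le
  simpa [perp_apply, angularDeriv] using this

/-- The term `2 * φ` is the divergence of the identity field on the plane. -/
theorem IsSobolevPair.abs_integral_mul_eulerDeriv_le (h : IsSobolevPair ξ g)
    (hφ : IsAnnularTest φ) :
    |∫ x, ξ x * (eulerDeriv φ x + 2 * φ x)| ≤ l2norm φ * l2norm g := by
  have := h.abs_integral_mul_div_le hφ (ContinuousLinearMap.id ℝ Plane) fun x => le_rfl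
  simpa [one_add_one_eq_two, eulerDeriv] using this

theorem IsAnnularTest.exists_bound (hφ : IsAnnularTest φ) : ∃ C, ∀ x, |φ x| ≤ C :=
  hφ.continuous.bounded_above_of_compact_support hφ.hasCompactSupport

theorem IsAnnularTest.stronglyMeasurable_comp_twist (hφ : IsAnnularTest φ) (t : ℝ) :
    StronglyMeasurable (Function.uncurry fun s x => φ (twist s t x)) := by
  have : Continuous fun p : ℝ × Plane => φ (twist p.1 t p.2) :=
    hφ.continuous.comp (by fun_prop)
  exact this.stronglyMeasurable

theorem integral_mul_comp_twist_sub (hξ : Integrable ξ) (hφ : IsAnnularTest φ) (t : ℝ) {a b : ℝ}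
    (hab : a ≤ b) :
    (∫ x, ξ x * φ (twist b t x)) - ∫ x, ξ x * φ (twist a t x) =
      ∫ s in a..b, ∫ x, ξ x * angularDeriv φ (twist s t x) := by
  obtain ⟨C, hC⟩ := hφ.exists_bound
  obtain ⟨C', hC'⟩ := hφ.angularDeriv.exists_bound
  have hi : ∀ s, Integrable fun x => ξ x * φ (twist s t x) := fun s =>
    hξ.mul_bdd (c := C) (hφ.comp_twist s t).continuous.aestronglyMeasurable
      (Eventually.of_forall fun x => hC _)
  rw [intervalIntegral_integral_mul_swap hξ (hφ.angularDeriv.stronglyMeasurable_comp_twist t)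
    (fun s x => hC' _) hab, ← integral_sub (hi b) (hi a)]
  refine integral_congr_ae (Eventually.of_forall fun x => ?_)
  have hcont : Continuous fun s => angularDeriv φ (twist s t x) :=
    hφ.angularDeriv.continuous.comp (by fun_prop)
  simp only
  rw [intervalIntegral.integral_eq_sub_of_hasDerivAt
    (fun s _ => hasDerivAt_comp_twist_left hφ.differentiable t x s)
    (hcont.intervalIntegrable a b), mul_sub]

/-- The angular derivative commutes with the twist, and the twist preserves the `L²` norm, so the
bound does not grow with `t`. -/
theorem IsSobolevPair.abs_integral_mul_angularDeriv_comp_le (h : IsSobolevPair ξ g)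
    (hφ : IsAnnularTest φ) (a t : ℝ) :
    |∫ x, ξ x * angularDeriv φ (twist a t x)| ≤ l2norm φ * l2norm g := by
  have := h.abs_integral_mul_angularDeriv_le (hφ.comp_twist a t)
  simp only [angularDeriv_comp_twist hφ] at this
  rwa [l2norm_comp_twist hφ.continuous.aestronglyMeasurable] at this

theorem IsSobolevPair.abs_integral_mul_comp_twist_sub_le (h : IsSobolevPair ξ g)
    (hφ : IsAnnularTest φ) {a : ℝ} (ha : 0 ≤ a) (t : ℝ) :
    |(∫ x, ξ x * φ (twist a t x)) - ∫ x, ξ x * φ (twist 0 t x)| ≤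
      a * (l2norm φ * l2norm g) := by
  rw [integral_mul_comp_twist_sub h.integrable hφ t ha]
  have := intervalIntegral.norm_integral_le_of_norm_le_const (a := 0) (b := a)
    (f := fun s => ∫ x, ξ x * angularDeriv φ (twist s t x)) (C := l2norm φ * l2norm g)
    fun s _ => h.abs_integral_mul_angularDeriv_comp_le hφ s t
  rwa [sub_zero, abs_of_nonneg ha, mul_comm] at this

/-- For smooth functions, rotations act on the twisted function with an error `O(1 / t)`. -/
theorem IsAnnularTest.exists_decay (hφ : IsAnnularTest φ) :
    ∃ C, ∀ (ξ : Plane → ℝ) (g : Plane → Plane), IsSobolevPair ξ g → l2norm g ≤ 1 →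
      ∀ t, t ≠ 0 → ∀ a ∈ Icc 0 (2 * Real.pi),
        |(∫ x, ξ x * φ (twist a t x)) - ∫ x, ξ x * φ (twist 0 t x)| ≤ C / |t| := by
  -- Dividing by `‖x‖` makes the shear term `t ‖x‖ ∂_θ η` of `eulerDeriv_comp_twist` equal to `t ∂_θ
  -- φ`.
  set η : Plane → ℝ := fun x => ‖x‖⁻¹ * φ x with hη_def
  have hη : IsAnnularTest η := hφ.mul_left fun x hx =>
    (contDiffAt_norm ℝ hx).inv (norm_ne_zero_iff.2 hx)
  have hφη : ∀ x, φ x = ‖x‖ * η x := by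
    intro x
    by_cases hx : x = 0
    · subst hx
      simp [image_eq_zero_of_notMem_tsupport (zero_notMem_of_subset hφ.tsupport_subset)]
    · simp [hη_def, hx]
  have hang : ∀ x, DiskMixing.angularDeriv φ x = ‖x‖ * DiskMixing.angularDeriv η x := by
    intro x
    have h1 := hasDerivAt_comp_twist_left hφ.differentiable 0 x 0
    have h2 := (hasDerivAt_comp_twist_left hη.differentiable 0 x 0).const_mul ‖x‖
    simp only [hφη (twist _ _ _), norm_twist] at h1
    simpa [twist_zero_zero] using h1.unique h2
  set κ : Plane → ℝ := fun x => DiskMixing.eulerDeriv η x + 2 * η x with hκ_def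
  have hκ : IsAnnularTest κ := hη.eulerDeriv.add (hη.mul_left fun x _ => contDiffAt_const)
  set B : ℝ := l2norm η + 2 * Real.pi * l2norm κ with hB
  have hη0 := l2norm_nonneg η
  have hκ0 := l2norm_nonneg κ
  have hπ := Real.two_pi_pos
  refine ⟨2 * Real.pi * (2 * B), fun ξ g h hg t ht => ?_⟩
  set q : ℝ → ℝ := fun s => ∫ x, ξ x * DiskMixing.angularDeriv φ (twist s t x) with hq
  set K : ℝ → ℝ := fun s => ∫ x, ξ x * κ (twist s t x) with hK
  -- The gradient of `ξ` controls the oscillation of `K` directly, but not yet its size, as `‖ξ‖` is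
  -- not bounded.
  have hKle : ∀ s ∈ Icc 0 (2 * Real.pi), |K s - K 0| ≤ 2 * Real.pi * l2norm κ := fun s hs => by
    refine (h.abs_integral_mul_comp_twist_sub_le hκ hs.1 t).trans ?_
    exact mul_le_mul hs.2 (mul_le_of_le_one_right hκ0 hg) (mul_nonneg hκ0 (l2norm_nonneg g)) hπ.le
  have hint : ∀ {ψ : Plane → ℝ}, IsAnnularTest ψ → Integrable fun x => ξ x * ψ x := fun hψ =>
    h.memLp.integrable_mul (hψ.memLp 2)
  have htq : ∀ s, t * q s = (∫ x, ξ x * (DiskMixing.eulerDeriv (fun x => η (twist s t x)) x +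
      2 * η (twist s t x))) - K s := by
    intro s
    have hs := hη.comp_twist s t
    rw [hq, hK, ← integral_const_mul, ← integral_sub
      (hint (hs.eulerDeriv.add (hs.mul_left fun x _ => contDiffAt_const)))
      (hint (hκ.comp_twist s t))]
    refine integral_congr_ae (Eventually.of_forall fun x => ?_)
    simp only [hκ_def, eulerDeriv_comp_twist hη, hang, norm_twist]
    ring
  have hqK : ∀ s ∈ Icc 0 (2 * Real.pi), |t * q s + K 0| ≤ B := fun s hs => by
    have h1 := h.abs_integral_mul_eulerDeriv_le (hη.comp_twist s t)
    rw [l2norm_comp_twist hη.continuous.aestronglyMeasurable] at h1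
    have h2 := hKle s hs
    rw [htq, hB]
    have h3 : l2norm η * l2norm g ≤ l2norm η := mul_le_of_le_one_right hη0 hg
    rw [abs_le] at h1 h2 ⊢
    constructor <;> linarith
  obtain ⟨C', hC'⟩ := hφ.angularDeriv.exists_bound
  have hqi : IntervalIntegrable q volume 0 (2 * Real.pi) :=
    intervalIntegrable_integral_mul h.integrable
      (hφ.angularDeriv.stronglyMeasurable_comp_twist t) (fun s x => hC' _) hπ.le
  -- `q` is the angular derivative of a periodic function.
  have hq0 : ∫ s in 0..2 * Real.pi, q s = 0 := by
    rw [← integral_mul_comp_twist_sub h.integrable hφ t hπ.le]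
    simp only [twist_two_pi, sub_self]
  -- Averaging `t * q s + K 0` over a full turn removes `q`, so `K 0` inherits the bound `B`.
  have hK0 : |K 0| ≤ B := by
    have h1 : ∫ s in 0..2 * Real.pi, (t * q s + K 0) = 2 * Real.pi * K 0 := by
      rw [intervalIntegral.integral_add (hqi.const_mul t) (by simp),
        intervalIntegral.integral_const_mul, hq0]
      simp
    have h2 := intervalIntegral.norm_integral_le_of_norm_le_const (a := 0) (b := 2 * Real.pi)
      (f := fun s => t * q s + K 0) (C := B) fun s hs => hqK s (by
        rw [uIoc_of_le hπ.le] at hs; exact Ioc_subset_Icc_self hs)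
    rw [h1, sub_zero, abs_of_pos hπ, Real.norm_eq_abs, abs_mul, abs_of_pos hπ, mul_comm B] at h2
    exact le_of_mul_le_mul_left h2 hπ
  intro a ha
  have hqb : ∀ s ∈ Icc 0 (2 * Real.pi), |q s| ≤ 2 * B / |t| := fun s hs => by
    rw [le_div_iff₀ (abs_pos.2 ht), mul_comm, ← abs_mul]
    have h1 := hqK s hs
    rw [abs_le] at h1 hK0 ⊢
    constructor <;> linarith
  rw [integral_mul_comp_twist_sub h.integrable hφ t ha.1]
  have h2 := intervalIntegral.norm_integral_le_of_norm_le_const (a := 0) (b := a)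
      (f := q) (C := 2 * B / |t|) fun s hs => hqb s (by
        rw [uIoc_of_le ha.1] at hs; exact ⟨hs.1.le, hs.2.trans ha.2⟩)
  refine h2.trans ?_
  rw [sub_zero, abs_of_nonneg ha.1, mul_comm, mul_div_assoc (2 * Real.pi)]
  have hB0 : 0 ≤ 2 * B / |t| := by positivity
  exact mul_le_mul_of_nonneg_right ha.2 hB0

theorem l2norm_le_of_eLpNorm_le {f : Plane → ℝ} {c : ℝ} (hc : 0 ≤ c)
    (h : eLpNorm f 2 volume ≤ ENNReal.ofReal c) : l2norm f ≤ c :=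
  ENNReal.toReal_le_of_le_ofReal hc h

theorem l2norm_le_add {f φ : Plane → ℝ} (hf : MemLp f 2 volume) (hφ : MemLp φ 2 volume) :
    l2norm φ ≤ l2norm f + l2norm (f - φ) := by
  have h := eLpNorm_sub_le (μ := volume) hf.1 (hf.sub hφ).1 one_le_two
  rw [sub_sub_cancel] at h
  have := ENNReal.toReal_mono
    (ENNReal.add_ne_top.2 ⟨hf.eLpNorm_ne_top, (hf.sub hφ).eLpNorm_ne_top⟩) h
  rwa [ENNReal.toReal_add hf.eLpNorm_ne_top (hf.sub hφ).eLpNorm_ne_top] at this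

/-! ### Extension of the rotation estimate to square-integrable functions -/

section Pairing

variable {ξ : Plane → ℝ} {g : Plane → Plane} {f φ : Plane → ℝ}

theorem abs_integral_mul_comp_twist_le (hξ : MemLp ξ 2 volume) (hf : MemLp f 2 volume)
    (a t : ℝ) : |∫ x, ξ x * f (twist a t x)| ≤ l2norm ξ * l2norm f := by
  rw [← l2norm_comp_twist hf.1 a t]
  exact abs_integral_le_l2norm_mul hξ (MemLp.comp_twist hf a t) fun x => (abs_mul _ _).le

theorem integral_mul_comp_twist_decomp (hξ : MemLp ξ 2 volume) (hf : MemLp f 2 volume)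
    (hφ : MemLp φ 2 volume) (a t : ℝ) :
    ∫ x, ξ x * f (twist a t x) =
      (∫ x, ξ x * φ (twist a t x)) + ∫ x, ξ x * (f - φ) (twist a t x) := by
  have h1 : Integrable fun x => ξ x * φ (twist a t x) :=
    hξ.integrable_mul (MemLp.comp_twist hφ a t)
  have h2 : Integrable fun x => ξ x * (f - φ) (twist a t x) :=
    hξ.integrable_mul (MemLp.comp_twist (hf.sub hφ) a t)
  rw [← integral_add h1 h2]
  refine integral_congr_ae (Eventually.of_forall fun x => ?_)
  simp only [Pi.sub_apply]
  ring

/-- Rotations move Sobolev functions, paired with square-integrable functions, by at most the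
angle of rotation. -/
theorem IsSobolevPair.abs_sub_le_of_memLp (h : IsSobolevPair ξ g) (hg : l2norm g ≤ 1)
    (hf : MemLp f 2 volume) (h0 : ∀ x, x ∉ disk → f x = 0) {a : ℝ} (ha : 0 ≤ a) (t : ℝ) :
    |(∫ x, ξ x * f (twist a t x)) - ∫ x, ξ x * f (twist 0 t x)| ≤ a * l2norm f := by
  refine le_of_forall_pos_le_add fun ε hε => ?_
  have hξ0 := l2norm_nonneg ξ
  -- The approximation costs `η * (a + 2 * l2norm ξ)`. Here `η` may depend on `ξ`, since the
  -- limiting bound no longer involves `l2norm ξ`.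
  set η : ℝ := ε / (a + 2 * l2norm ξ + 1) with hη
  have hden : 0 < a + 2 * l2norm ξ + 1 := by positivity
  have hη0 : 0 < η := by positivity
  obtain ⟨φ, hφ, hfφ⟩ := exists_isAnnularTest_eLpNorm_sub_le hf h0 hη0
  have hφ2 := hφ.memLp 2
  have hfφ' := l2norm_le_of_eLpNorm_le hη0.le hfφ
  have h1 := h.abs_integral_mul_comp_twist_sub_le hφ ha t
  have h2 : a * (l2norm φ * l2norm g) ≤ a * (l2norm f + η) := by
    refine mul_le_mul_of_nonneg_left ?_ ha
    refine (mul_le_of_le_one_right (l2norm_nonneg φ) hg).trans ?_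
    linarith [l2norm_le_add hf hφ2]
  have h3 : ∀ b, |∫ x, ξ x * (f - φ) (twist b t x)| ≤ l2norm ξ * η := fun b =>
    (abs_integral_mul_comp_twist_le h.memLp (hf.sub hφ2) b t).trans (by gcongr)
  have h4 : η * (a + 2 * l2norm ξ) ≤ ε := by
    rw [hη, div_mul_eq_mul_div, div_le_iff₀ hden]
    nlinarith
  rw [integral_mul_comp_twist_decomp h.memLp hf hφ2 a t,
    integral_mul_comp_twist_decomp h.memLp hf hφ2 0 t]
  have h5 := h3 a
  have h6 := h3 0
  rw [abs_le] at h1 h5 h6 ⊢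
  constructor <;> nlinarith

end Pairing

/-! ### Decay for data with vanishing circle averages -/

/-- Bounded measurable functions supported in the disk with vanishing circle averages. -/
structure IsCircleMeanZero (f : Plane → ℝ) : Prop where
  stronglyMeasurable : StronglyMeasurable f
  bounded : ∃ C, ∀ x, |f x| ≤ C
  eq_zero : ∀ x, x ∉ disk → f x = 0
  circle_average : ∀ᵐ x : Plane, ∫ s in (0 : ℝ)..(2 * Real.pi), f (twist s 0 x) = 0

namespace IsCircleMeanZero

variable {f : Plane → ℝ}

theorem memLp (hf : IsCircleMeanZero f) (p : ℝ≥0∞) : MemLp f p volume := by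
  obtain ⟨C, hC⟩ := hf.bounded
  exact memLp_indicator_disk (memLp_top_of_bound hf.stronglyMeasurable.aestronglyMeasurable C
    (Eventually.of_forall hC)) hf.eq_zero

theorem stronglyMeasurable_comp_twist (hf : IsCircleMeanZero f) (t : ℝ) :
    StronglyMeasurable (Function.uncurry fun s x => f (twist s t x)) := by
  have : Continuous fun p : ℝ × Plane => twist p.1 t p.2 := by fun_prop
  exact hf.stronglyMeasurable.comp_measurable this.measurable

theorem circle_average_twist (hf : IsCircleMeanZero f) (t : ℝ) :
    ∀ᵐ x : Plane, ∫ s in (0 : ℝ)..(2 * Real.pi), f (twist s t x) = 0 := by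
  filter_upwards [(measurePreserving_twist 0 t).quasiMeasurePreserving.ae hf.circle_average]
    with x hx
  simpa [twist_twist] using hx

/-- Decay of the pairing with Sobolev functions, uniformly in the Sobolev function. -/
theorem exists_decay (hf : IsCircleMeanZero f) {ε : ℝ} (hε : 0 < ε) :
    ∃ T, 0 < T ∧ ∀ (ξ : Plane → ℝ) (g : Plane → Plane), IsSobolevPair ξ g → l2norm g ≤ 1 →
      ∀ t, T ≤ |t| → |∫ x, ξ x * f (twist 0 t x)| ≤ ε := by
  have hπ := Real.two_pi_pos
  have hf2 := hf.memLp 2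
  -- With this accuracy, rotating `f - φ` by an angle of at most `2π` costs at most `ε / 2`.
  obtain ⟨φ, hφ, hfφ⟩ := exists_isAnnularTest_eLpNorm_sub_le hf2 hf.eq_zero
    (ε := ε / (2 * (2 * Real.pi))) (by positivity)
  have hφ2 := hφ.memLp 2
  have hfφ' := l2norm_le_of_eLpNorm_le (by positivity) hfφ
  obtain ⟨C, hC⟩ := hφ.exists_decay
  refine ⟨2 * |C| / ε + 1, by positivity, fun ξ g h hg t ht => ?_⟩
  have ht0 : 0 < |t| := lt_of_lt_of_le (by positivity) ht
  have hCt : C / |t| ≤ ε / 2 := by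
    rw [div_le_iff₀ ht0]
    have h1 : 2 * |C| / ε ≤ |t| := by linarith
    rw [div_le_iff₀ hε] at h1
    linarith [le_abs_self C]
  set P : ℝ → ℝ := fun a => ∫ x, ξ x * f (twist a t x) with hP
  have hd : ∀ a ∈ Icc 0 (2 * Real.pi), |P a - P 0| ≤ ε := fun a ha => by
    have h1 := hC ξ g h hg t (abs_pos.1 ht0) a ha
    have h2 := h.abs_sub_le_of_memLp hg (hf2.sub hφ2)
      (fun x hx => by simp [hf.eq_zero x hx, hφ.eq_zero hx]) ha.1 t
    have h3 : a * l2norm (f - φ) ≤ ε / 2 := by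
      calc a * l2norm (f - φ) ≤ 2 * Real.pi * (ε / (2 * (2 * Real.pi))) :=
            mul_le_mul ha.2 hfφ' (l2norm_nonneg _) hπ.le
        _ = ε / 2 := by field_simp
    simp only [hP]
    rw [integral_mul_comp_twist_decomp h.memLp hf2 hφ2 a t,
      integral_mul_comp_twist_decomp h.memLp hf2 hφ2 0 t]
    rw [abs_le] at h1 h2 ⊢
    constructor <;> linarith
  obtain ⟨M, hM⟩ := hf.bounded
  have hPi : IntervalIntegrable P volume 0 (2 * Real.pi) :=
    intervalIntegrable_integral_mul h.integrable (hf.stronglyMeasurable_comp_twist t)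
      (fun s x => hM _) hπ.le
  have hP0 : ∫ a in 0..2 * Real.pi, P a = 0 := by
    rw [hP, intervalIntegral_integral_mul_swap h.integrable (hf.stronglyMeasurable_comp_twist t)
      (fun s x => hM _) hπ.le, integral_congr_ae (g := 0), Pi.zero_def, integral_zero]
    filter_upwards [hf.circle_average_twist t] with x hx
    simp [hx]
  -- As `P` has mean zero, its oscillation bounds `P 0` itself.
  have h1 : ∫ a in 0..2 * Real.pi, (P a - P 0) = -(2 * Real.pi * P 0) := by
    rw [intervalIntegral.integral_sub hPi (by simp), hP0]
    simp
  have h2 := intervalIntegral.norm_integral_le_of_norm_le_const (a := 0) (b := 2 * Real.pi)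
    (f := fun a => P a - P 0) (C := ε) fun s hs => hd s (by
      rw [uIoc_of_le hπ.le] at hs; exact Ioc_subset_Icc_self hs)
  rw [h1, sub_zero, abs_of_pos hπ, Real.norm_eq_abs, abs_neg, abs_mul, abs_of_pos hπ,
    mul_comm ε] at h2
  exact le_of_mul_le_mul_left h2 hπ

end IsCircleMeanZero

/-! ### Representatives of admissible data -/

/-- Each twist preserves null sets, and Fubini exchanges the quantifiers. This lets circle averages
be compared for functions that agree only almost everywhere. -/
theorem ae_ae_twist {P : Plane → Prop} (h : ∀ᵐ x, P x) (t : ℝ) :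
    ∀ᵐ x : Plane, ∀ᵐ s : ℝ, P (twist s t x) := by
  obtain ⟨N, hN, hNm, hN0⟩ := exists_measurable_superset_of_null h
  have hc : Continuous fun p : ℝ × Plane => twist p.1 t p.2 := by fun_prop
  have hm : MeasurableSet {p : ℝ × Plane | twist p.1 t p.2 ∉ N} := hc.measurable hNm.compl
  have h1 : ∀ᵐ s : ℝ, ∀ᵐ x : Plane, twist s t x ∉ N := Eventually.of_forall fun s =>
    (measurePreserving_twist s t).quasiMeasurePreserving.ae (measure_eq_zero_iff_ae_notMem.1 hN0)
  have h2 : ∀ᵐ x : Plane, ∀ᵐ s : ℝ, twist s t x ∉ N := (Measure.ae_ae_comm hm).1 h1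
  filter_upwards [h2] with x hx
  filter_upwards [hx] with s hs
  by_contra hP
  exact hs (hN hP)

theorem polar_add_two_pi (r θ : ℝ) : polar r (θ + 2 * Real.pi) = polar r θ := by simp [polar]

/-- The canonical representative of an admissible datum. -/
theorem IsAdmissibleDatum.exists_isCircleMeanZero {ρ₀ : Plane → ℝ} (h : IsAdmissibleDatum ρ₀) :
    ∃ f, IsCircleMeanZero f ∧ f =ᵐ[volume] ρ₀ := by
  set C : ℝ := (eLpNorm ρ₀ ⊤ volume).toReal with hC
  have hC0 : 0 ≤ C := ENNReal.toReal_nonneg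
  have hmk : StronglyMeasurable (h.memLp.1.mk ρ₀) := h.memLp.1.stronglyMeasurable_mk
  -- Truncation and restriction to the open disk make the bound and the support condition hold
  -- everywhere; the class is unchanged because the unit circle is null.
  set f : Plane → ℝ := disk.indicator fun x => max (-C) (min C (h.memLp.1.mk ρ₀ x)) with hf
  have hbd : ∀ᵐ x, |ρ₀ x| ≤ C := by
    filter_upwards [ae_le_eLpNormEssSup (f := ρ₀) (μ := volume)] with x hx
    have hfin : eLpNormEssSup ρ₀ volume ≠ ⊤ := by
      simpa [eLpNorm_exponent_top] using h.memLp.eLpNorm_ne_top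
    rw [hC, eLpNorm_exponent_top, ← Real.norm_eq_abs, ← toReal_enorm]
    exact ENNReal.toReal_mono hfin hx
  have hsph : ∀ᵐ x : Plane, x ∉ Metric.sphere (0 : Plane) 1 :=
    measure_eq_zero_iff_ae_notMem.1 (Measure.addHaar_sphere _ _ _)
  have hae : f =ᵐ[volume] ρ₀ := by
    filter_upwards [hbd, hsph, h.support, h.memLp.1.ae_eq_mk] with x h1 h2 h3 h4
    by_cases hx : x ∈ disk
    · rw [hf, indicator_of_mem hx, ← h4, min_eq_right (abs_le.1 h1).2,
        max_eq_right (abs_le.1 h1).1]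
    · rw [hf, indicator_of_notMem hx, h3]
      intro hc
      rw [← Metric.ball_union_sphere] at hc
      exact hc.elim hx h2
  refine ⟨f, ⟨?_, ⟨C, fun x => ?_⟩, fun x hx => indicator_of_notMem hx _, ?_⟩, hae⟩
  · exact ((measurable_const.max (measurable_const.min hmk.measurable)).indicator
      measurableSet_disk).stronglyMeasurable
  · by_cases hx : x ∈ disk
    · rw [hf, indicator_of_mem hx, abs_le]
      exact ⟨le_max_left _ _, max_le (by linarith) (min_le_left _ _)⟩
    · rwa [hf, indicator_of_notMem hx, abs_zero]
  · have h0 : ∀ᵐ x : Plane, x ≠ 0 := measure_eq_zero_iff_ae_notMem.1 (measure_singleton _)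
    filter_upwards [ae_norm_of_ae_pos h.circle_average, ae_ae_twist hae 0, h0] with x h1 h2 hx
    have h3 : ∫ s in (0 : ℝ)..(2 * Real.pi), f (twist s 0 x) =
        ∫ s in (0 : ℝ)..(2 * Real.pi), ρ₀ (twist s 0 x) := by
      refine intervalIntegral.integral_congr_ae ?_
      filter_upwards [h2] with s hs _ using hs
    rw [h3]
    obtain ⟨β, hβ⟩ := exists_eq_polar x
    have h4 : ∀ s, twist s 0 x = polar ‖x‖ (β + s) := fun s => by
      rw [twist, zero_mul, add_zero]
      conv_lhs => rw [hβ, rot_polar]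
    simp only [h4]
    have hper : Function.Periodic (fun θ => ρ₀ (polar ‖x‖ θ)) (2 * Real.pi) := fun θ => by
      simp only [polar_add_two_pi]
    rw [intervalIntegral.integral_comp_add_left (fun θ => ρ₀ (polar ‖x‖ θ)) β, add_zero,
      hper.intervalIntegral_add_eq β 0, zero_add]
    exact h1 hx

/-! ### Existence of weak solutions -/

/-- The angular velocity `-2π‖x‖` is linear in the radius, which makes the flow a twist. -/
theorem velocity_eq (x : Plane) : velocity x = (-(2 * Real.pi * ‖x‖)) • perp x := by
  ext i
  fin_cases i <;> simp [velocity, perp_apply]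

theorem continuous_velocity : Continuous velocity := by
  have : velocity = fun x => (-(2 * Real.pi * ‖x‖)) • perp x := funext velocity_eq
  rw [this]
  fun_prop

/-- The derivative along the velocity field. -/
def transportDeriv (φ : Plane → ℝ) (x : Plane) : ℝ := fderiv ℝ φ x (velocity x)

variable {φ : Plane → ℝ}

theorem transportDeriv_eq (φ : Plane → ℝ) (x : Plane) :
    transportDeriv φ x = -(2 * Real.pi * ‖x‖) * angularDeriv φ x := by
  rw [transportDeriv, velocity_eq, map_smul, smul_eq_mul, angularDeriv]

/-- The flow of the velocity field. -/
def flow (s : ℝ) (x : Plane) : Plane := twist 0 (-(2 * Real.pi * s)) x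

theorem flow_zero (x : Plane) : flow 0 x = x := by simp [flow, twist_zero_zero]

theorem flow_flow_neg (s : ℝ) (x : Plane) : flow s (flow (-s) x) = x := by
  simp [flow, twist_twist, twist_zero_zero]

theorem norm_flow (s : ℝ) (x : Plane) : ‖flow s x‖ = ‖x‖ := norm_twist _ _ _

theorem flow_mem_disk {s : ℝ} {x : Plane} : flow s x ∈ disk ↔ x ∈ disk := twist_mem_disk

theorem measurePreserving_flow (s : ℝ) : MeasurePreserving (flow s) := measurePreserving_twist _ _

theorem measurableEmbedding_flow (s : ℝ) : MeasurableEmbedding (flow s) :=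
  measurableEmbedding_twist _ _

theorem continuous_flow : Continuous fun p : ℝ × Plane => flow p.1 p.2 := by
  unfold flow
  fun_prop

theorem hasDerivAt_comp_flow (h : Differentiable ℝ φ) (x : Plane) (s : ℝ) :
    HasDerivAt (fun s => φ (flow s x)) (transportDeriv φ (flow s x)) s := by
  have h1 : HasDerivAt (fun s : ℝ => -(2 * Real.pi * s)) (-(2 * Real.pi)) s := by
    simpa using! ((hasDerivAt_id s).const_mul (2 * Real.pi)).neg
  have h2 := (hasDerivAt_comp_twist_right h 0 x (-(2 * Real.pi * s))).comp s h1
  have h3 : transportDeriv φ (flow s x) =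
      ‖x‖ * angularDeriv φ (twist 0 (-(2 * Real.pi * s)) x) * -(2 * Real.pi) := by
    rw [transportDeriv_eq, norm_flow, flow]
    ring
  rw [h3]
  exact h2

theorem integral_comp_flow_mul (f φ : Plane → ℝ) (s : ℝ) :
    ∫ x, f (flow (-s) x) * φ x = ∫ x, f x * φ (flow s x) := by
  rw [← (measurePreserving_flow (-s)).integral_comp (measurableEmbedding_flow (-s))
    fun x => f x * φ (flow s x)]
  simp only [flow_flow_neg]

theorem stronglyMeasurable_comp_flow {h : Plane → ℝ} (hh : StronglyMeasurable h) :
    StronglyMeasurable (Function.uncurry fun s x => h (flow s x)) :=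
  hh.comp_measurable continuous_flow.measurable

theorem continuous_transportDeriv (h : ContDiff ℝ ∞ φ) : Continuous (transportDeriv φ) :=
  (h.continuous_fderiv (by simp)).clm_apply continuous_velocity

theorem hasCompactSupport_transportDeriv (h : HasCompactSupport φ) :
    HasCompactSupport (transportDeriv φ) := by
  refine (h.fderiv ℝ).mono fun x hx hc => hx ?_
  simp [transportDeriv, hc]

/-- Only the time derivative of `φ (flow s x)` enters, so `φ` may be nonzero at the origin.
Existence needs this generality. -/
theorem integral_mul_comp_flow_sub {ξ : Plane → ℝ} (hξ : Integrable ξ) (h : ContDiff ℝ ∞ φ)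
    (hc : HasCompactSupport φ) {a b : ℝ} (hab : a ≤ b) :
    (∫ x, ξ x * φ (flow b x)) - ∫ x, ξ x * φ (flow a x) =
      ∫ s in a..b, ∫ x, ξ x * transportDeriv φ (flow s x) := by
  obtain ⟨C, hC⟩ := h.continuous.bounded_above_of_compact_support hc
  have hS := continuous_transportDeriv h
  obtain ⟨C', hC'⟩ := hS.bounded_above_of_compact_support (hasCompactSupport_transportDeriv hc)
  have hflow : ∀ s, Continuous fun x => flow s x := fun s => by unfold flow; fun_prop
  have hi : ∀ s, Integrable fun x => ξ x * φ (flow s x) := fun s =>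
    hξ.mul_bdd (c := C) (h.continuous.comp (hflow s)).aestronglyMeasurable
      (Eventually.of_forall fun x => hC _)
  rw [intervalIntegral_integral_mul_swap hξ (stronglyMeasurable_comp_flow hS.stronglyMeasurable)
    (fun s x => hC' _) hab, ← integral_sub (hi b) (hi a)]
  refine integral_congr_ae (Eventually.of_forall fun x => ?_)
  have hfl : Continuous fun s => flow s x := by unfold flow; fun_prop
  have hcont : Continuous fun s => transportDeriv φ (flow s x) := hS.comp hfl
  simp only
  rw [intervalIntegral.integral_eq_sub_of_hasDerivAt
    (fun s _ => hasDerivAt_comp_flow (h.differentiable (by simp)) x s)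
    (hcont.intervalIntegrable a b), mul_sub]

theorem IsCircleMeanZero.isWeakSolution {f ρ₀ : Plane → ℝ} (hf : IsCircleMeanZero f)
    (hfρ : f =ᵐ[volume] ρ₀) : IsWeakSolution velocity ρ₀ fun t x => f (flow (-t) x) where
  measurable := by
    have : Continuous fun p : ℝ × Plane => flow (-p.1) p.2 := by unfold flow; fun_prop
    exact (hf.stronglyMeasurable.comp_measurable this.measurable).aestronglyMeasurable
  measurable_slice t _ :=
    hf.stronglyMeasurable.aestronglyMeasurable.comp_measurePreserving (measurePreserving_flow _)
  bounded := by
    obtain ⟨C, hC⟩ := hf.bounded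
    exact ⟨C, fun t _ => Eventually.of_forall fun x => hC _⟩
  support t _ := Eventually.of_forall fun x hx => hf.eq_zero _ fun hd =>
    hx (Metric.ball_subset_closedBall (flow_mem_disk.1 hd))
  equation φ hφ t ht := by
    have hS0 : ∀ x, x ∉ disk → transportDeriv φ x = 0 := fun x hx => by
      simp [transportDeriv, hφ.fderiv_eq_zero hx]
    have h1 : ∫ x in disk, ρ₀ x * φ x = ∫ x, f x * φ x := by
      rw [setIntegral_disk_eq fun x hx => by simp [hφ.eq_zero hx]]
      refine integral_congr_ae ?_
      filter_upwards [hfρ] with x hx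
      rw [hx]
    have h2 : ∀ s, ∫ x in disk, f (flow (-s) x) * fderiv ℝ φ x (velocity x) =
        ∫ x, f x * transportDeriv φ (flow s x) := fun s => by
      rw [setIntegral_disk_eq fun x hx => by simp [hφ.fderiv_eq_zero hx],
        ← integral_comp_flow_mul f (transportDeriv φ) s]
      rfl
    simp only [h2]
    rw [h1, setIntegral_disk_eq fun x hx => by simp [hφ.eq_zero hx], integral_comp_flow_mul,
      ← integral_mul_comp_flow_sub (memLp_one_iff_integrable.1 (hf.memLp 1)) hφ.1 hφ.2.1 ht]
    simp only [flow_zero]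
    ring

/-! ### Uniqueness of weak solutions -/

theorem IsAnnularTest.comp_flow (h : IsAnnularTest φ) (s : ℝ) :
    IsAnnularTest fun x => φ (flow s x) :=
  h.comp_twist _ _

theorem IsAnnularTest.transportDeriv (h : IsAnnularTest φ) : IsAnnularTest (transportDeriv φ) := by
  rw [show DiskMixing.transportDeriv φ = _ from funext (transportDeriv_eq φ)]
  refine h.angularDeriv.mul_left fun x hx => ?_
  have hn : ContDiffAt ℝ ∞ (fun y : Plane => ‖y‖) x := contDiffAt_norm ℝ hx
  fun_prop

theorem transportDeriv_comp_flow (h : IsAnnularTest φ) (s : ℝ) (x : Plane) :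
    transportDeriv (fun x => φ (flow s x)) x = transportDeriv φ (flow s x) := by
  rw [transportDeriv_eq, transportDeriv_eq, norm_flow]
  exact congrArg _ (angularDeriv_comp_twist h _ _ x)

/-- Quadratic increments force a zero derivative. In the duality argument this replaces a product
rule in time. -/
theorem eq_of_abs_sub_le_sq {F : ℝ → ℝ} {K t : ℝ} (ht : 0 ≤ t)
    (hF : ∀ x y, 0 ≤ x → x ≤ y → y ≤ t → |F y - F x| ≤ K * (y - x) ^ 2) : F t = F 0 := by
  have hF' : ∀ x ∈ Icc 0 t, ∀ y ∈ Icc 0 t, |F y - F x| ≤ K * (y - x) ^ 2 := by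
    intro x hx y hy
    rcases le_total x y with h | h
    · exact hF x y hx.1 h hy.2
    · rw [abs_sub_comm, ← neg_sub x y, neg_sq]
      exact hF y x hy.1 h hx.2
  have hd : ∀ x ∈ Icc 0 t, HasDerivWithinAt F 0 (Icc 0 t) x := by
    intro x hx
    rw [hasDerivWithinAt_iff_isLittleO]
    have h1 : (fun y => F y - F x - (y - x) • (0 : ℝ)) =O[𝓝[Icc 0 t] x] fun y => (y - x) ^ 2 := by
      refine Asymptotics.IsBigO.of_bound K ?_
      filter_upwards [self_mem_nhdsWithin] with y hy
      simpa using hF' x hx y hy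
    have h2 := (Asymptotics.isLittleO_pow_sub_sub x one_lt_two).mono
      (nhdsWithin_le_nhds (s := Icc 0 t))
    simp only [Real.norm_eq_abs, sq_abs] at h2
    exact h1.trans_isLittleO h2
  refine constant_of_derivWithin_zero (fun x hx => (hd x hx).differentiableWithinAt)
    (fun x hx => ?_) t (right_mem_Icc.2 ht)
  rcases eq_or_lt_of_le ht with h0 | h0
  · exact absurd hx (by simp [← h0])
  · exact (hd x (Ico_subset_Icc_self hx)).derivWithin
      (uniqueDiffOn_Icc h0 x (Ico_subset_Icc_self hx))

theorem abs_integral_sub_mul_le {u : ℝ → ℝ} {a b c L : ℝ} (hab : a ≤ b)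
    (hu : IntervalIntegrable u volume a b) (h : ∀ s ∈ Icc a b, |u s - c| ≤ L * (b - a)) :
    |(∫ s in a..b, u s) - (b - a) * c| ≤ L * (b - a) ^ 2 := by
  have h1 : (∫ s in a..b, u s) - (b - a) * c = ∫ s in a..b, (u s - c) := by
    rw [intervalIntegral.integral_sub hu (by simp), intervalIntegral.integral_const, smul_eq_mul]
  rw [h1, sq, ← mul_assoc]
  have := intervalIntegral.norm_integral_le_of_norm_le_const (a := a) (b := b)
    (f := fun s => u s - c) (C := L * (b - a)) fun s hs => h s (by
      rw [uIoc_of_le hab] at hs; exact Ioc_subset_Icc_self hs)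
  rwa [abs_of_nonneg (sub_nonneg.2 hab)] at this

namespace IsWeakSolution

variable {v : Plane → Plane} {ρ₀ : Plane → ℝ} {ρ : ℝ → Plane → ℝ}

theorem integrable_indicator (h : IsWeakSolution v ρ₀ ρ) {t : ℝ} (ht : 0 ≤ t) :
    Integrable (disk.indicator (ρ t)) := by
  obtain ⟨C, hC⟩ := h.bounded
  rw [integrable_indicator_iff measurableSet_disk]
  exact Measure.integrableOn_of_bounded (M := C) measure_ball_lt_top.ne (h.measurable_slice t ht)
    (ae_restrict_of_ae (hC t ht))

theorem integral_eq (ρ : ℝ → Plane → ℝ) (φ : Plane → ℝ) (t : ℝ) :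
    ∫ x in disk, ρ t x * φ x = ∫ x, disk.indicator (ρ t) x * φ x := by
  rw [← integral_indicator measurableSet_disk]
  refine integral_congr_ae (Eventually.of_forall fun x => ?_)
  by_cases hx : x ∈ disk <;> simp [hx]

theorem exists_bound (h : IsWeakSolution v ρ₀ ρ) (hφ : IsAnnularTest φ) :
    ∃ K, ∀ a, 0 ≤ a → ∀ b, |∫ x in disk, ρ a x * φ (flow b x)| ≤ K := by
  obtain ⟨C, hC⟩ := h.bounded
  obtain ⟨M, hM⟩ := hφ.exists_bound
  refine ⟨C * M * volume.real disk, fun a ha b => ?_⟩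
  have hlt : volume disk < ⊤ := measure_ball_lt_top
  refine norm_setIntegral_le_of_norm_le_const_ae' (f := fun x => ρ a x * φ (flow b x)) hlt ?_
  filter_upwards [hC a ha] with x hx _
  rw [norm_mul]
  exact mul_le_mul hx (hM _) (norm_nonneg _) ((abs_nonneg _).trans hx)

theorem intervalIntegrable (h : IsWeakSolution v ρ₀ ρ) (hφ : IsAnnularTest φ) {a b : ℝ}
    (ha : 0 ≤ a) (hab : a ≤ b) :
    IntervalIntegrable (fun s => ∫ x in disk, ρ s x * φ x) volume a b := by
  rw [intervalIntegrable_iff_integrableOn_Ioc_of_le hab]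
  obtain ⟨K, hK⟩ := h.exists_bound hφ
  have h1 : AEStronglyMeasurable (fun p : ℝ × Plane => ρ p.1 p.2 * φ p.2)
      ((volume.restrict (Ici (0 : ℝ))).prod (volume.restrict disk)) :=
    h.measurable.mul hφ.continuous.aestronglyMeasurable.comp_snd
  have hsub : Ioc a b ⊆ Ici (0 : ℝ) := fun s hs => ha.trans hs.1.le
  have h2 : AEStronglyMeasurable (fun s => ∫ x in disk, ρ s x * φ x) (volume.restrict (Ioc a b)) :=
    h1.integral_prod_right'.mono_measure (Measure.restrict_mono hsub le_rfl)
  refine ⟨h2, HasFiniteIntegral.of_bounded (C := K) ?_⟩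
  filter_upwards [ae_restrict_mem measurableSet_Ioc] with s hs
  simpa [flow_zero] using hK s (ha.trans hs.1.le) 0

theorem integral_sub_eq (h : IsWeakSolution velocity ρ₀ ρ) (hφ : IsAnnularTest φ) {a b : ℝ}
    (ha : 0 ≤ a) (hab : a ≤ b) :
    (∫ x in disk, ρ b x * φ x) - ∫ x in disk, ρ a x * φ x =
      ∫ s in a..b, ∫ x in disk, ρ s x * transportDeriv φ x := by
  rw [h.equation φ hφ.isTestFunction a ha, h.equation φ hφ.isTestFunction b (ha.trans hab),
    add_sub_add_left_eq_sub, intervalIntegral.integral_interval_sub_left]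
  · rfl
  · exact h.intervalIntegrable hφ.transportDeriv le_rfl (ha.trans hab)
  · exact h.intervalIntegrable hφ.transportDeriv le_rfl ha

theorem integral_comp_flow_sub_eq (h : IsWeakSolution v ρ₀ ρ) (hφ : IsAnnularTest φ) {t : ℝ}
    (ht : 0 ≤ t) {a b : ℝ} (hab : a ≤ b) :
    (∫ x in disk, ρ t x * φ (flow b x)) - ∫ x in disk, ρ t x * φ (flow a x) =
      ∫ s in a..b, ∫ x in disk, ρ t x * transportDeriv φ (flow s x) := by
  simp only [integral_eq ρ (fun x => φ (flow _ x)),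
    integral_eq ρ (fun x => DiskMixing.transportDeriv φ (flow _ x))]
  exact integral_mul_comp_flow_sub (h.integrable_indicator ht) hφ.contDiff
    hφ.hasCompactSupport hab

theorem intervalIntegrable_flow (h : IsWeakSolution v ρ₀ ρ) (hφ : IsAnnularTest φ) {t : ℝ}
    (ht : 0 ≤ t) {a b : ℝ} (hab : a ≤ b) :
    IntervalIntegrable (fun s => ∫ x in disk, ρ t x * φ (flow s x)) volume a b := by
  simp only [integral_eq ρ (fun x => φ (flow _ x))]
  obtain ⟨C, hC⟩ := hφ.exists_bound
  exact intervalIntegrable_integral_mul (h.integrable_indicator ht)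
    (stronglyMeasurable_comp_flow hφ.continuous.stronglyMeasurable) (fun s x => hC _) hab

/-- The solution is transported by the flow, in duality with test functions. -/
theorem integral_eq_integral_comp_flow (h : IsWeakSolution velocity ρ₀ ρ)
    (hφ : IsAnnularTest φ) {t : ℝ} (ht : 0 ≤ t) :
    ∫ x in disk, ρ t x * φ x = ∫ x in disk, ρ₀ x * φ (flow t x) := by
  obtain ⟨K, hK⟩ := h.exists_bound hφ.transportDeriv.transportDeriv
  have hS : ∀ {ψ : Plane → ℝ}, IsAnnularTest ψ → ∀ b,
      DiskMixing.transportDeriv (fun x => ψ (flow b x)) =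
        fun x => DiskMixing.transportDeriv ψ (flow b x) :=
    fun hψ b => funext fun x => transportDeriv_comp_flow hψ b x
  -- The time of the solution and the time of the flow are separated; `H` is Lipschitz in each, with
  -- a constant from the second transport derivative.
  set H : ℝ → ℝ → ℝ := fun a b => ∫ x in disk, ρ a x * DiskMixing.transportDeriv φ (flow b x)
    with hH
  have hH1 : ∀ a a' b, 0 ≤ a → a ≤ a' → |H a' b - H a b| ≤ K * (a' - a) := by
    intro a a' b ha haa
    rw [hH, h.integral_sub_eq (hφ.transportDeriv.comp_flow b) ha haa, hS hφ.transportDeriv]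
    have := intervalIntegral.norm_integral_le_of_norm_le_const (a := a) (b := a') (C := K)
      (f := fun s => ∫ x in disk, ρ s x *
        DiskMixing.transportDeriv (DiskMixing.transportDeriv φ) (flow b x)) fun s hs => hK s (by
          rw [uIoc_of_le haa] at hs; exact ha.trans hs.1.le) b
    rwa [abs_of_nonneg (sub_nonneg.2 haa)] at this
  have hH2 : ∀ a b b', 0 ≤ a → b ≤ b' → |H a b' - H a b| ≤ K * (b' - b) := by
    intro a b b' ha hbb
    rw [hH, h.integral_comp_flow_sub_eq hφ.transportDeriv ha hbb]
    have := intervalIntegral.norm_integral_le_of_norm_le_const (a := b) (b := b') (C := K)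
      (f := fun s => ∫ x in disk, ρ a x *
        DiskMixing.transportDeriv (DiskMixing.transportDeriv φ) (flow s x)) fun s hs => hK a ha s
    rwa [abs_of_nonneg (sub_nonneg.2 hbb)] at this
  have hK0 : 0 ≤ K := (abs_nonneg _).trans (hK 0 le_rfl 0)
  -- Between `s` and `s'`, advancing the solution and shortening the flow time contribute `± (s' -
  -- s) * H s (t - s')`, each up to `K * (s' - s) ^ 2`; the leading terms cancel.
  have key : ∀ s s', 0 ≤ s → s ≤ s' → s' ≤ t →
      |(∫ x in disk, ρ s' x * φ (flow (t - s') x)) - ∫ x in disk, ρ s x * φ (flow (t - s) x)| ≤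
        (2 * K) * (s' - s) ^ 2 := by
    intro s s' hs hss hst
    have hts : t - s' ≤ t - s := by linarith
    have e1 := h.integral_sub_eq (hφ.comp_flow (t - s')) hs hss
    rw [hS hφ] at e1
    have e2 := h.integral_comp_flow_sub_eq hφ hs hts
    have b1 := abs_integral_sub_mul_le (u := fun σ => H σ (t - s')) (c := H s (t - s')) (L := K)
      hss (h.intervalIntegrable (hφ.transportDeriv.comp_flow (t - s')) hs hss) fun σ hσ =>
      (hH1 s σ _ hs hσ.1).trans (by nlinarith [hσ.2])
    have b2 := abs_integral_sub_mul_le (u := fun σ => H s σ) (c := H s (t - s')) (L := K)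
      hts (h.intervalIntegrable_flow hφ.transportDeriv hs hts) fun σ hσ =>
      (hH2 s _ σ hs hσ.1).trans (by nlinarith [hσ.2])
    rw [← e1] at b1
    rw [← e2, show t - s - (t - s') = s' - s by ring] at b2
    rw [abs_le] at b1 b2 ⊢
    constructor <;> linarith
  have hconst := eq_of_abs_sub_le_sq
    (F := fun s => ∫ x in disk, ρ s x * φ (flow (t - s) x)) ht key
  have h0 := h.equation _ (hφ.comp_flow t).isTestFunction 0 le_rfl
  simp only [sub_self, flow_zero, sub_zero] at hconst
  rw [hconst, h0, intervalIntegral.integral_same, add_zero]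

/-- Duality determines `ρ t` on the punctured open disk; the origin and the unit circle are null. -/
theorem ae_eq (h : IsWeakSolution velocity ρ₀ ρ) {f : Plane → ℝ} (hf : IsCircleMeanZero f)
    (hfρ : f =ᵐ[volume] ρ₀) {t : ℝ} (ht : 0 ≤ t) :
    ρ t =ᵐ[volume] fun x => f (flow (-t) x) := by
  have hfi : Integrable fun x => f (flow (-t) x) :=
    (measurePreserving_flow (-t)).integrable_comp_of_integrable
      (memLp_one_iff_integrable.1 (hf.memLp 1))
  have hU : IsOpen (disk \ {0} : Set Plane) := Metric.isOpen_ball.sdiff isClosed_singleton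
  have hint : Integrable fun x => disk.indicator (ρ t) x - f (flow (-t) x) :=
    (h.integrable_indicator ht).sub hfi
  have h1 := hU.ae_eq_zero_of_integral_contDiff_smul_eq_zero
    (hint.locallyIntegrable.locallyIntegrableOn _) fun φ hφ hφc hφs => by
      have hφ' : IsAnnularTest φ := ⟨hφ, hφc, hφs⟩
      obtain ⟨C, hC⟩ := hφ'.exists_bound
      have e1 := h.integral_eq_integral_comp_flow hφ' ht
      have e2 : ∫ x in disk, ρ₀ x * φ (flow t x) = ∫ x, f (flow (-t) x) * φ x := by
        rw [integral_comp_flow_mul,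
          setIntegral_disk_eq fun x hx => by simp [(hφ'.comp_flow t).eq_zero hx]]
        refine integral_congr_ae ?_
        filter_upwards [hfρ] with x hx
        rw [hx]
      rw [integral_eq ρ φ, e2] at e1
      have i1 : Integrable fun x => disk.indicator (ρ t) x * φ x :=
        (h.integrable_indicator ht).mul_bdd (c := C) hφ'.continuous.aestronglyMeasurable
          (Eventually.of_forall hC)
      have i2 : Integrable fun x => f (flow (-t) x) * φ x :=
        hfi.mul_bdd (c := C) hφ'.continuous.aestronglyMeasurable (Eventually.of_forall hC)
      simp only [smul_eq_mul, mul_comm (φ _), sub_mul]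
      rw [integral_sub i1 i2, e1, sub_self]
  have h0 : ∀ᵐ x : Plane, x ≠ 0 := measure_eq_zero_iff_ae_notMem.1 (measure_singleton _)
  have hsph : ∀ᵐ x : Plane, x ∉ Metric.sphere (0 : Plane) 1 :=
    measure_eq_zero_iff_ae_notMem.1 (Measure.addHaar_sphere _ _ _)
  filter_upwards [h1, h0, hsph, h.support t ht] with x h1 h0 h2 h3
  by_cases hx : x ∈ disk
  · have := h1 ⟨hx, h0⟩
    rw [indicator_of_mem hx] at this
    exact sub_eq_zero.1 this
  · rw [hf.eq_zero _ (fun hd => hx (flow_mem_disk.1 hd)), h3]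
    intro hc
    rw [← Metric.ball_union_sphere] at hc
    exact hc.elim hx h2

end IsWeakSolution

/-! ### Smooth functions as Sobolev functions -/

theorem gradient_apply (ζ : Plane → ℝ) (y : Plane) (i : Fin 2) :
    gradient ζ y i = fderiv ℝ ζ y (EuclideanSpace.single i 1) := by
  have h : inner ℝ (gradient ζ y) (EuclideanSpace.single i (1 : ℝ)) =
      fderiv ℝ ζ y (EuclideanSpace.single i 1) := InnerProductSpace.toDual_symm_apply
  rw [EuclideanSpace.inner_single_right] at h
  simpa using h

theorem norm_gradient (ζ : Plane → ℝ) (y : Plane) : ‖gradient ζ y‖ = ‖fderiv ℝ ζ y‖ :=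
  LinearIsometryEquiv.norm_map _ _

theorem isSobolevWithGradient_gradient {ζ : Plane → ℝ} (hζ : ContDiff ℝ ∞ ζ) {C D : ℝ}
    (hC : ∀ y, |ζ y| ≤ C) (hD : ∀ y, ‖fderiv ℝ ζ y‖ ≤ D) :
    IsSobolevWithGradient ζ (gradient ζ) where
  memLp := MemLp.of_bound hζ.continuous.aestronglyMeasurable C (Eventually.of_forall hC)
  memLp_gradient := by
    have hc : Continuous (gradient ζ) :=
      (InnerProductSpace.toDual ℝ Plane).symm.continuous.comp (hζ.continuous_fderiv (by simp))
    exact MemLp.of_bound hc.aestronglyMeasurable D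
      (Eventually.of_forall fun y => (norm_gradient ζ y).trans_le (hD y))
  weak_gradient φ hφ i := by
    rw [setIntegral_disk_eq fun x hx => by simp [hφ.fderiv_eq_zero hx],
      setIntegral_disk_eq fun x hx => by simp [hφ.eq_zero hx]]
    simp only [gradient_apply]
    have hζ' : Continuous fun x => fderiv ℝ ζ x (EuclideanSpace.single i 1) :=
      (hζ.continuous_fderiv (by simp)).clm_apply continuous_const
    have hφ' : Continuous fun x => fderiv ℝ φ x (EuclideanSpace.single i 1) :=
      (hφ.1.continuous_fderiv (by simp)).clm_apply continuous_const
    refine integral_mul_fderiv_eq_neg_fderiv_mul_of_integrable ?_ ?_ ?_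
      (fun x _ => hζ.differentiable (by simp) x) (fun x _ => hφ.1.differentiable (by simp) x)
    · exact (hζ'.mul hφ.1.continuous).integrable_of_hasCompactSupport hφ.2.1.mul_left
    · exact (hζ.continuous.mul hφ').integrable_of_hasCompactSupport
        (hφ.2.1.fderiv_apply ℝ _).mul_left
    · exact (hζ.continuous.mul hφ.1.continuous).integrable_of_hasCompactSupport hφ.2.1.mul_left

/-! ### Mixing -/

section Mixing

variable {f : Plane → ℝ}

theorem eventually_abs_setIntegral_le (hf : IsCircleMeanZero f) {ε : ℝ} (hε : 0 < ε) :
    ∀ᶠ t : ℝ in atTop, ∀ (ξ : Plane → ℝ) (g : Plane → Plane), IsSobolevWithGradient ξ g →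
      eLpNorm g 2 (volume.restrict disk) ≤ 1 → |∫ x in disk, f (flow (-t) x) * ξ x| ≤ ε := by
  obtain ⟨T, hT, h⟩ := hf.exists_decay hε
  filter_upwards [eventually_ge_atTop T] with t ht ξ g hξ hg
  have hg' : l2norm (disk.indicator g) ≤ 1 := by
    rw [l2norm, eLpNorm_indicator_eq_eLpNorm_restrict measurableSet_disk]
    exact ENNReal.toReal_le_of_le_ofReal zero_le_one (by simpa using hg)
  -- `flow (-t)` is the twist with shear `2πt`, which is at least `t`.
  have h1 := h _ _ hξ.isSobolevPair hg' (-(2 * Real.pi * -t)) (by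
    rw [mul_neg, neg_neg, abs_mul, abs_of_pos Real.two_pi_pos, abs_of_nonneg (hT.le.trans ht)]
    nlinarith [Real.pi_gt_three])
  rw [← integral_indicator measurableSet_disk]
  refine le_trans (le_of_eq ?_) h1
  congr 1
  refine integral_congr_ae (Eventually.of_forall fun x => ?_)
  by_cases hx : x ∈ disk
  · simp [hx, flow, mul_comm]
  · simp [hx]

theorem tendsto_negSobolevNorm (hf : IsCircleMeanZero f) {ρ : ℝ → Plane → ℝ}
    (hρ : ∀ t, 0 ≤ t → ρ t =ᵐ[volume] fun x => f (flow (-t) x)) :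
    Tendsto (fun t : ℝ => negSobolevNorm (ρ t)) atTop (𝓝 0) := by
  refine ENNReal.tendsto_nhds_zero.2 fun ε hε => ?_
  obtain ⟨δ, hδ, hδε⟩ : ∃ δ : ℝ, 0 < δ ∧ ENNReal.ofReal δ ≤ ε := by
    rcases eq_or_ne ε ⊤ with rfl | hε'
    · exact ⟨1, one_pos, le_top⟩
    · exact ⟨ε.toReal, ENNReal.toReal_pos hε.ne' hε', (ENNReal.ofReal_toReal hε').le⟩
  filter_upwards [eventually_abs_setIntegral_le hf hδ, eventually_ge_atTop 0] with t ht ht0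
  refine iSup_le fun ξ => iSup_le fun g => iSup_le fun hξ => iSup_le fun hg => ?_
  refine le_trans (ENNReal.ofReal_le_ofReal ?_) hδε
  refine le_trans (le_of_eq ?_) ((le_abs_self _).trans (ht ξ g hξ hg))
  refine integral_congr_ae (ae_restrict_of_ae ?_)
  filter_upwards [hρ t ht0] with x hx
  rw [hx]

/-! ### From Sobolev test functions to means over disks -/

theorem volume_real_ball (x : Plane) {r : ℝ} (hr : 0 < r) :
    volume.real (Metric.ball x r) = r ^ 2 * volume.real disk := by
  rw [Measure.real, Measure.addHaar_ball _ _ hr.le, ENNReal.toReal_mul,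
    ENNReal.toReal_ofReal (by positivity)]
  simp [disk, Measure.real]

theorem volume_real_disk_pos : 0 < volume.real disk :=
  ENNReal.toReal_pos (Metric.measure_ball_pos _ _ one_pos).ne' measure_ball_lt_top.ne

/-- Pairings with the translates of a fixed bump function decay uniformly. -/
theorem eventually_abs_integral_translate_le (hf : IsCircleMeanZero f) {η : Plane → ℝ}
    (hη : ContDiff ℝ ∞ η) (hηc : HasCompactSupport η) {ε : ℝ} (hε : 0 < ε) :
    ∀ᶠ t : ℝ in atTop, ∀ x, |∫ y, f (flow (-t) y) * η (y - x)| ≤ ε := by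
  obtain ⟨C, hC⟩ := hη.continuous.bounded_above_of_compact_support hηc
  obtain ⟨D, hD⟩ := (hη.continuous_fderiv (by simp)).bounded_above_of_compact_support
    (hηc.fderiv ℝ)
  have hD0 : 0 ≤ D := (norm_nonneg _).trans (hD 0)
  set W : ℝ≥0∞ := (volume.restrict disk) univ ^ (2 : ℝ≥0∞).toReal⁻¹ with hW
  have hWt : W ≠ ⊤ := ENNReal.rpow_ne_top_of_nonneg (by positivity) (measure_ne_top _ _)
  -- Dividing by `L` brings the `L²(disk)` norm of the gradient below `1` for every translate at
  -- once, since `D` does not depend on `x`.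
  set L : ℝ := W.toReal * D + 1 with hL
  have hW0 : 0 ≤ W.toReal := ENNReal.toReal_nonneg
  have hL0 : 0 < L := by positivity
  filter_upwards [eventually_abs_setIntegral_le hf (ε := L⁻¹ * ε) (by positivity)] with t ht x
  set ζ : Plane → ℝ := fun y => L⁻¹ * η (y - x) with hζ
  have hζs : ContDiff ℝ ∞ ζ := contDiff_const.mul (hη.comp (contDiff_id.sub contDiff_const))
  have hζC : ∀ y, |ζ y| ≤ L⁻¹ * C := fun y => by
    rw [hζ, abs_mul, abs_of_pos (inv_pos.2 hL0)]
    exact mul_le_mul_of_nonneg_left (hC _) (inv_pos.2 hL0).le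
  have hζD : ∀ y, ‖fderiv ℝ ζ y‖ ≤ L⁻¹ * D := fun y => by
    have h1 : fderiv ℝ ζ y = L⁻¹ • fderiv ℝ η (y - x) := by
      have hd : DifferentiableAt ℝ (fun y => η (y - x)) y :=
        (hη.comp (contDiff_id.sub contDiff_const)).differentiable (by simp) y
      rw [hζ, fderiv_const_mul hd, fderiv_comp_sub]
    rw [h1, norm_smul, Real.norm_of_nonneg (inv_pos.2 hL0).le]
    exact mul_le_mul_of_nonneg_left (hD _) (inv_pos.2 hL0).le
  have hnorm : eLpNorm (gradient ζ) 2 (volume.restrict disk) ≤ 1 := by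
    refine (eLpNorm_le_of_ae_bound (C := L⁻¹ * D)
      (Eventually.of_forall fun y => (norm_gradient ζ y).trans_le (hζD y))).trans ?_
    rw [← hW, ← ENNReal.ofReal_toReal hWt, ← ENNReal.ofReal_mul hW0, ENNReal.ofReal_le_one]
    have : W.toReal * (L⁻¹ * D) = W.toReal * D / L := by ring
    rw [this, div_le_one hL0, hL]
    linarith
  have h1 := ht ζ _ (isSobolevWithGradient_gradient hζs hζC hζD) hnorm
  have h0 : ∀ y, y ∉ disk → f (flow (-t) y) * ζ y = 0 := fun y hy => by
    rw [hf.eq_zero _ fun h => hy (flow_mem_disk.1 h), zero_mul]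
  rw [setIntegral_disk_eq h0] at h1
  have h2 : ∫ y, f (flow (-t) y) * ζ y = L⁻¹ * ∫ y, f (flow (-t) y) * η (y - x) := by
    rw [← integral_const_mul]
    refine integral_congr_ae (Eventually.of_forall fun y => ?_)
    simp only [hζ]
    ring
  rw [h2, abs_mul, abs_of_pos (inv_pos.2 hL0)] at h1
  exact le_of_mul_le_mul_left h1 (inv_pos.2 hL0)

theorem IsCircleMeanZero.ae_abs_flow_le (hf : IsCircleMeanZero f) (t : ℝ) :
    ∀ᵐ x, |f (flow t x)| ≤ (eLpNorm f ⊤ (volume.restrict disk)).toReal := by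
  have hfin : eLpNormEssSup f (volume.restrict disk) ≠ ⊤ := by
    simpa [eLpNorm_exponent_top] using ((hf.memLp ⊤).restrict disk).eLpNorm_ne_top
  have h1 : ∀ᵐ x, |f x| ≤ (eLpNorm f ⊤ (volume.restrict disk)).toReal := by
    filter_upwards [(ae_restrict_iff' measurableSet_disk).1
      (ae_le_eLpNormEssSup (f := f) (μ := volume.restrict disk))] with x hx
    by_cases hd : x ∈ disk
    · rw [eLpNorm_exponent_top, ← Real.norm_eq_abs, ← toReal_enorm]
      exact ENNReal.toReal_mono hfin (hx hd)
    · rw [hf.eq_zero x hd, abs_zero]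
      exact ENNReal.toReal_nonneg
  exact (measurePreserving_flow t).quasiMeasurePreserving.ae h1

theorem IsCircleMeanZero.eLpNorm_comp_flow (hf : IsCircleMeanZero f) (t : ℝ) :
    eLpNorm (fun x => f (flow t x)) ⊤ (volume.restrict disk) =
      eLpNorm f ⊤ (volume.restrict disk) := by
  have h1 : MeasurePreserving (flow t) (volume.restrict disk) (volume.restrict disk) := by
    have h2 := (measurePreserving_flow t).restrict_preimage measurableSet_disk
    have h3 : flow t ⁻¹' disk = disk := by ext x; exact flow_mem_disk
    rwa [h3] at h2
  exact eLpNorm_comp_measurePreserving hf.stronglyMeasurable.aestronglyMeasurable h1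

theorem eventually_abs_setIntegral_ball_le (hf : IsCircleMeanZero f) {κ ε : ℝ} (hκ : 0 < κ)
    (hε : 0 < ε) :
    ∀ᶠ t : ℝ in atTop, ∀ x, |∫ y in Metric.ball x ε, f (flow (-t) y)| ≤
      κ * (eLpNorm f ⊤ (volume.restrict disk)).toReal * volume.real (Metric.ball x ε) := by
  set M := (eLpNorm f ⊤ (volume.restrict disk)).toReal with hM
  have hMn : 0 ≤ M := ENNReal.toReal_nonneg
  rcases hMn.eq_or_lt with hM0 | hM0
  · refine Eventually.of_forall fun t x => ?_
    have : ∫ y in Metric.ball x ε, f (flow (-t) y) = 0 := by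
      refine integral_eq_zero_of_ae (ae_restrict_of_ae ?_)
      filter_upwards [hf.ae_abs_flow_le (-t)] with y hy
      rw [← hM, ← hM0] at hy
      exact abs_nonpos_iff.1 hy
    rw [this, ← hM0]
    simp
  have hV := volume_real_disk_pos
  -- With this radius the annulus between `ε` and `R` has `κ / 2` times the area of the `ε`-disk.
  -- Replacing the indicator by the bump uses half of the allowed error, and the decay of the bump
  -- pairing the other half.
  set R : ℝ := ε * √(1 + κ / 2) with hR
  have hR2 : R ^ 2 = ε ^ 2 * (1 + κ / 2) := by
    rw [hR, mul_pow, Real.sq_sqrt (by positivity)]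
  have hεR : ε < R := by
    have : 0 < ε ^ 2 * κ := by positivity
    exact lt_of_pow_lt_pow_left₀ 2 (by positivity) (by nlinarith)
  let η : ContDiffBump (0 : Plane) := ⟨ε, R, hε, hεR⟩
  filter_upwards [eventually_abs_integral_translate_le hf η.contDiff η.hasCompactSupport
    (ε := κ / 2 * M * (ε ^ 2 * volume.real disk)) (by positivity)] with t ht x
  set F : Plane → ℝ := fun y => f (flow (-t) y) with hF
  have hFi : Integrable F := (measurePreserving_flow (-t)).integrable_comp_of_integrable
    (memLp_one_iff_integrable.1 (hf.memLp 1))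
  have hi1 : Integrable ((Metric.ball x ε).indicator F) := hFi.indicator measurableSet_ball
  have hi2 : Integrable fun y => F y * η (y - x) := by
    refine hFi.mul_bdd (c := 1) ?_ (Eventually.of_forall fun y => ?_)
    · exact (η.continuous.comp (continuous_id.sub continuous_const)).aestronglyMeasurable
    · rw [Real.norm_of_nonneg η.nonneg]
      exact η.le_one
  have hsub : Metric.ball x ε ⊆ Metric.ball x R := Metric.ball_subset_ball hεR.le
  have hpt : ∀ᵐ y, ‖(Metric.ball x ε).indicator F y - F y * η (y - x)‖ ≤
      (Metric.ball x R \ Metric.ball x ε).indicator (fun _ => M) y := by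
    filter_upwards [hf.ae_abs_flow_le (-t)] with y hy
    by_cases h1 : y ∈ Metric.ball x ε
    · have : η (y - x) = 1 := η.one_of_mem_closedBall (by
        rw [mem_closedBall_zero_iff, ← dist_eq_norm]; exact (Metric.mem_ball.1 h1).le)
      simp [h1, this]
    · by_cases h2 : y ∈ Metric.ball x R
      · have hmem : y ∈ Metric.ball x R \ Metric.ball x ε := ⟨h2, h1⟩
        rw [indicator_of_notMem h1, indicator_of_mem hmem, zero_sub, norm_neg, norm_mul,
          Real.norm_of_nonneg (η.nonneg' _)]
        exact (mul_le_of_le_one_right (norm_nonneg _) η.le_one).trans hy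
      · have : η (y - x) = 0 := η.zero_of_le_dist (by
          rw [dist_zero_right, ← dist_eq_norm]
          exact not_lt.1 fun h => h2 (Metric.mem_ball.2 h))
        rw [indicator_of_notMem h1, indicator_of_notMem fun h => h2 h.1, this]
        simp
  have hmd : MeasurableSet (Metric.ball x R \ Metric.ball x ε) :=
    measurableSet_ball.diff measurableSet_ball
  have hlt : volume (Metric.ball x R \ Metric.ball x ε) ≠ ⊤ :=
    ((measure_mono sdiff_subset).trans_lt measure_ball_lt_top).ne
  have hdiff : |(∫ y in Metric.ball x ε, F y) - ∫ y, F y * η (y - x)| ≤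
      κ / 2 * M * (ε ^ 2 * volume.real disk) := by
    rw [← integral_indicator measurableSet_ball, ← integral_sub hi1 hi2]
    refine (norm_integral_le_of_norm_le
      ((integrable_indicator_iff hmd).2 (integrableOn_const hlt)) hpt).trans (le_of_eq ?_)
    rw [integral_indicator hmd, setIntegral_const, smul_eq_mul,
      measureReal_sdiff hsub measurableSet_ball, volume_real_ball x (hε.trans hεR),
      volume_real_ball x hε, hR2]
    ring
  have h3 := ht x
  rw [volume_real_ball x hε]
  rw [abs_le] at hdiff h3 ⊢
  constructor <;> nlinarith

/-- The flow conserves the sup norm, so the threshold is independent of `t`. As the scale is an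
infimum, it suffices that one small radius is eventually admissible. -/
theorem tendsto_geometricMixingScale (hf : IsCircleMeanZero f) {ρ : ℝ → Plane → ℝ}
    (hρ : ∀ t, 0 ≤ t → ρ t =ᵐ[volume] fun x => f (flow (-t) x)) {κ : ℝ} (hκ : 0 < κ) :
    Tendsto (fun t : ℝ => geometricMixingScale κ (ρ t)) atTop (𝓝 0) := by
  refine ENNReal.tendsto_nhds_zero.2 fun ε hε => ?_
  obtain ⟨δ, hδ, hδε⟩ : ∃ δ : ℝ, 0 < δ ∧ ENNReal.ofReal δ ≤ ε := by
    rcases eq_or_ne ε ⊤ with rfl | hε'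
    · exact ⟨1, one_pos, le_top⟩
    · exact ⟨ε.toReal, ENNReal.toReal_pos hε.ne' hε', (ENNReal.ofReal_toReal hε').le⟩
  filter_upwards [eventually_abs_setIntegral_ball_le hf hκ hδ, eventually_ge_atTop 0]
    with t ht ht0
  refine le_trans ?_ hδε
  refine iInf_le_of_le δ (iInf_le_of_le hδ (iInf_le_of_le (fun x => ?_) le_rfl))
  have h1 : eLpNorm (ρ t) ⊤ (volume.restrict disk) = eLpNorm f ⊤ (volume.restrict disk) :=
    (eLpNorm_congr_ae (ae_restrict_of_ae (hρ t ht0))).trans (hf.eLpNorm_comp_flow _)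
  have h2 : eLpNorm f ⊤ (volume.restrict disk) ≠ ⊤ :=
    ((hf.memLp ⊤).restrict disk).eLpNorm_ne_top
  rw [h1, ← ENNReal.ofReal_toReal h2, ← ENNReal.ofReal_mul hκ.le]
  refine ENNReal.ofReal_le_ofReal ?_
  have hpos : 0 < volume.real (Metric.ball x δ) := by
    rw [volume_real_ball x hδ]
    exact mul_pos (by positivity) volume_real_disk_pos
  rw [setAverage_eq, setIntegral_congr_ae (g := fun y => f (flow (-t) y)) measurableSet_ball
    ((hρ t ht0).mono fun y hy _ => hy), smul_eq_mul, abs_mul, abs_of_pos (inv_pos.2 hpos),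
    inv_mul_le_iff₀ hpos, mul_comm]
  exact ht x

end Mixing

end DiskMixing

end

theorem theorem1p5 (ρ₀ : DiskMixing.Plane → ℝ) (hρ₀ : DiskMixing.IsAdmissibleDatum ρ₀) :
    (∃ ρ : ℝ → DiskMixing.Plane → ℝ,
      DiskMixing.IsWeakSolution DiskMixing.velocity ρ₀ ρ) ∧
    ∀ ρ : ℝ → DiskMixing.Plane → ℝ,
      DiskMixing.IsWeakSolution DiskMixing.velocity ρ₀ ρ →
        (∀ κ : ℝ, 0 < κ → κ < 1 →
          Tendsto (fun t : ℝ => DiskMixing.geometricMixingScale κ (ρ t)) atTop (𝓝 0)) ∧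
        Tendsto (fun t : ℝ => DiskMixing.negSobolevNorm (ρ t)) atTop (𝓝 0) := by
  obtain ⟨f, hf, hfρ⟩ := hρ₀.exists_isCircleMeanZero
  refine ⟨⟨_, hf.isWeakSolution hfρ⟩, fun ρ hρ => ?_⟩
  have h : ∀ t, 0 ≤ t → ρ t =ᵐ[volume] fun x => f (DiskMixing.flow (-t) x) :=
    fun t ht => hρ.ae_eq hf hfρ ht
  exact ⟨fun κ hκ _ => DiskMixing.tendsto_geometricMixingScale hf h hκ,
    DiskMixing.tendsto_negSobolevNorm hf h⟩
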